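/- **Conventions.** Identify $\mathbb R^2$ with $\mathbb C$. For $k\in\{0,1,2\}$ a pointed $k$-chain is a finite formal sum $A=\sum_i(p_i;\alpha_i)$ with $p_i\in\mathbb C$, $\alpha_i\in\Lambda^k T_{p_i}\mathbb R^2$ (a finitely supported section of $\Lambda^kT\mathbb R^2$); $\|\alpha\|$ is the mass of $\alpha$. Put $\Delta_u(p;\alpha)=(p+u;\alpha)-(p;\alpha)$ and $\Delta_U^j=\Delta_{u_1}\circ\cdots\circ\Delta_{u_j}$ for $U=(u_1,\dots,u_j)$, with $|\Delta^j_U(p;\alpha)|_j=\|u_1\|\cdots\|u_j\|\,\|\alpha\|$. For $r\ge 0$ let $$\|A\|_{B^r}=\inf\Big\{\sum_i|\Delta^{j_i}_{U_i}(p_i;\alpha_i)|_{j_i}\;:\;A=\sum_i\Delta^{j_i}_{U_i}(p_i;\alpha_i),\ 0\le j_i\le r\Big\},$$ and let $\hat{\mathcal B}^r_k$ (real differential $k$-chains of order $r$) be the completion of the pointed $k$-chains in this norm; the identity on pointed chains induces canonical injective maps $\hat{\mathcal B}_k^r\to\hat{\mathcal B}_k^{r+1}$. Let $\mathcal B^r_k$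 be the space of $k$-forms $\omega$ on $\mathbb C$ (real or complex valued) for which there is $C$ with $|\omega(\Delta_U^j(p;\alpha))|\le C\,|\Delta_U^j(p;\alpha)|_j$ for all $j\le r$; such $\omega$ extends continuously to $\hat{\mathcal B}^r_k$, and $\int_J\omega:=\omega(J)$. A closed set $X$ supports $J\in\hat{\mathcal B}^r_k$ if for every non-empty open $W\supseteq X$, $J$ is a limit in $\hat{\mathcal B}_k^r$ of pointed chains in $W$; $\operatorname{supp}J$ is the intersection of all closed sets supporting $J$, and $J$ is supported in $U$ if $\operatorname{supp}J\subseteq U$. If a form $\omega$ is defined near $\operatorname{supp}J$ and coincides on a neighbourhood of $\operatorname{supp}J$ with some $\eta\in\mathcal B^r_k$, then $\int_J\omega:=\eta(J)$; the integral is called well-defined if such $\eta$ exists and $\eta(J)$ is the same for all of them. The mass of $K$ is $\inf\{\liminf_i\|A_i\|_{B^0}: A_i\to K,\ A_i \text{ pointed}\}$. Let $P_v(p;\alpha)=\lim_{t\to0}\big[(p+tv;\alpha/t)-(p;\alpha/t)\big]$, let $E_v^\dagger$ be the retraction given by $E_v^\dagger(p;w)=(p;\langle v,w\rangle)$ on $1$-vectors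 and $E_v^\dagger(p;a\wedge b)=(p;\langle v,a\rangle b-\langle v,b\rangle a)$ on $2$-vectors, and let $\partial=\sum_{i=1}^2P_{e_i}E_{e_i}^\dagger$, extended continuously to $\partial:\hat{\mathcal B}_k^{r}\to\hat{\mathcal B}_{k-1}^{r+1}$ for $r\ge1$ and $k=1,2$. A chain $J$ is closed if $\partial J=0$. For $K\in\hat{\mathcal B}_2^{r-1}$ and $J\in\hat{\mathcal B}_1^r$, $r\ge1$, the equation $\partial K=J$ is read in $\hat{\mathcal B}_1^{r+1}$ via the canonical maps. For a $1$-chain $J$ and $z\notin\operatorname{supp}J$ put $\operatorname{Ind}_J(z)=\frac1{2\pi i}\int_J\frac{dw}{w-z}$. **Theorem (Generalized Global Cauchy Integral Formula).** Let $r\ge 1$ and let $J\in\hat{\mathcal B}_1^r$ be closed and supported in a bounded open set $U\subset\mathbb C$, with $\operatorname{Ind}_J(w)=0$ for all $w\in\mathbb C\setminus U$. Suppose there is $K\in\hat{\mathcal B}_2^{r-1}$ of finite mass with $\partial K=J$. If $f$ is holomorphic on $U$ and $z\in U\setminus\operatorname{supp}J$, then the integrals below and in the definition of $\operatorname{Ind}_J(z)$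 are well-defined and $$f(z)\operatorname{Ind}_J(z)=\frac1{2\pi i}\int_J\frac{f(w)}{w-z}\,dw .$$ -/

import Mathlib

open Filter Topology Finsupp
open scoped ENNReal

namespace DifferentialChains

/-! The plane `ℝ²` is `ℂ`, with standard basis `1, I`.  The fibres of `Λᵏ T ℝ²` are
`Λ⁰ = ℝ`, `Λ¹ = ℂ`, and `Λ² = ℝ` (coordinate with respect to `e₁ ∧ e₂`).  In the plane every
`k`-vector is simple, so its mass is the Euclidean norm, i.e. `‖·‖` on `ℝ`, `ℂ`, `ℝ`.
A pointed `k`-chain is a finitely supported function `ℂ →₀ V`, `V = Λᵏ`;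
`(p; α)` is `single p α`. -/

section Pointed

variable {V : Type} [NormedAddCommGroup V] [NormedSpace ℝ V]

/-- Translation `T_u` of pointed chains. -/
noncomputable def translate (u : ℂ) : (ℂ →₀ V) →ₗ[ℝ] (ℂ →₀ V) :=
  Finsupp.lmapDomain V ℝ (fun p => p + u)

/-- The difference operator `Δ_u = T_u - Id`. -/
noncomputable def difference (u : ℂ) : (ℂ →₀ V) →ₗ[ℝ] (ℂ →₀ V) :=
  translate u - LinearMap.id

/-- `Δ_U^j = Δ_{u₁} ∘ ⋯ ∘ Δ_{u_j}`. -/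
noncomputable def iterDifference : List ℂ → (ℂ →₀ V) →ₗ[ℝ] (ℂ →₀ V)
  | [] => LinearMap.id
  | u :: U => difference u ∘ₗ iterDifference U

/-- The data `(U, p, α)` of a difference chain `Δ_U^j (p; α)`. -/
structure DiffTerm (V : Type) where
  dirs : List ℂ
  base : ℂ
  vec : V

/-- The difference chain `Δ_U^j (p; α)`. -/
noncomputable def DiffTerm.chain (x : DiffTerm V) : ℂ →₀ V :=
  iterDifference x.dirs (single x.base x.vec)

/-- `|Δ_U^j (p; α)|_j = ‖u₁‖ ⋯ ‖u_j‖ ‖α‖`. -/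
noncomputable def DiffTerm.weight (x : DiffTerm V) : ℝ :=
  (x.dirs.map (fun u => ‖u‖)).prod * ‖x.vec‖

/-- The values `∑ᵢ |Δ_{Uᵢ}(pᵢ; αᵢ)|` over all ways to write `A = ∑ᵢ Δ_{Uᵢ}(pᵢ; αᵢ)` with
all difference orders at most `r`. -/
def decompositionCosts (r : ℕ) (A : ℂ →₀ V) : Set ℝ :=
  {c | ∃ L : List (DiffTerm V), (∀ x ∈ L, x.dirs.length ≤ r) ∧
    A = (L.map DiffTerm.chain).sum ∧ c = (L.map DiffTerm.weight).sum}

/-- The `r`-norm `‖A‖_{B^r}`; for `r = 0` it is the mass norm. -/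
noncomputable def rNorm (r : ℕ) (A : ℂ →₀ V) : ℝ := sInf (decompositionCosts r A)

set_option linter.unusedSectionVars false in
theorem DiffTerm.weight_nonneg (x : DiffTerm V) : 0 ≤ x.weight := by
  refine mul_nonneg (List.prod_nonneg ?_) (norm_nonneg _)
  intro a ha
  obtain ⟨u, -, rfl⟩ := List.mem_map.1 ha
  exact norm_nonneg u

theorem costs_nonneg (r : ℕ) (A : ℂ →₀ V) : ∀ c ∈ decompositionCosts r A, 0 ≤ c := by
  rintro c ⟨L, -, -, rfl⟩
  refine List.sum_nonneg ?_
  intro a ha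
  obtain ⟨x, -, rfl⟩ := List.mem_map.1 ha
  exact x.weight_nonneg

theorem costs_bddBelow (r : ℕ) (A : ℂ →₀ V) : BddBelow (decompositionCosts r A) :=
  ⟨0, costs_nonneg r A⟩

theorem costs_add {r : ℕ} {A B : ℂ →₀ V} {a b : ℝ} (ha : a ∈ decompositionCosts r A)
    (hb : b ∈ decompositionCosts r B) : a + b ∈ decompositionCosts r (A + B) := by
  obtain ⟨L, h1, h2, h3⟩ := ha
  obtain ⟨M, k1, k2, k3⟩ := hb
  refine ⟨L ++ M, ?_, by simp [h2, k2], by simp [h3, k3]⟩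
  intro x hx
  rcases List.mem_append.1 hx with h | h
  exacts [h1 x h, k1 x h]

theorem cost_term {r : ℕ} (x : DiffTerm V) (hx : x.dirs.length ≤ r) :
    x.weight ∈ decompositionCosts r x.chain :=
  ⟨[x], by simpa using hx, by simp, by simp⟩

theorem costs_nonempty (r : ℕ) (A : ℂ →₀ V) : (decompositionCosts r A).Nonempty := by
  induction A using Finsupp.induction_linear with
  | zero => exact ⟨0, [], by simp, by simp, by simp⟩
  | add f g hf hg =>
    obtain ⟨a, ha⟩ := hf
    obtain ⟨b, hb⟩ := hg
    exact ⟨_, costs_add ha hb⟩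
  | single p α => exact ⟨_, cost_term (r := r) ⟨[], p, α⟩ (by simp)⟩

theorem rNorm_nonneg (r : ℕ) (A : ℂ →₀ V) : 0 ≤ rNorm r A :=
  Real.sInf_nonneg (costs_nonneg r A)

theorem rNorm_term_le {r : ℕ} (x : DiffTerm V) (hx : x.dirs.length ≤ r) :
    rNorm r x.chain ≤ x.weight :=
  csInf_le (costs_bddBelow _ _) (cost_term x hx)

theorem rNorm_zero (r : ℕ) : rNorm r (0 : ℂ →₀ V) = 0 :=
  le_antisymm (csInf_le (costs_bddBelow _ _) ⟨[], by simp, by simp, by simp⟩) (rNorm_nonneg r 0)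

theorem rNorm_add_le (r : ℕ) (A B : ℂ →₀ V) : rNorm r (A + B) ≤ rNorm r A + rNorm r B := by
  refine le_of_forall_pos_lt_add fun ε hε => ?_
  obtain ⟨a, ha, ha'⟩ := Real.lt_sInf_add_pos (costs_nonempty r A) (half_pos hε)
  obtain ⟨b, hb, hb'⟩ := Real.lt_sInf_add_pos (costs_nonempty r B) (half_pos hε)
  have := csInf_le (costs_bddBelow r (A + B)) (costs_add ha hb)
  unfold rNorm
  linarith

/-- A linear map into a seminormed space which is bounded on difference chains is bounded. -/
theorem norm_le_of_terms {G : Type*} [SeminormedAddCommGroup G] [NormedSpace ℝ G] {r : ℕ}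
    (T : (ℂ →₀ V) →ₗ[ℝ] G) {C : ℝ} (hC : 0 ≤ C)
    (h : ∀ x : DiffTerm V, x.dirs.length ≤ r → ‖T x.chain‖ ≤ C * x.weight) (A : ℂ →₀ V) :
    ‖T A‖ ≤ C * rNorm r A := by
  have key : ∀ c ∈ decompositionCosts r A, ‖T A‖ ≤ C * c := by
    rintro c ⟨L, h1, rfl, rfl⟩
    clear * - h1 h
    induction L with
    | nil => simp
    | cons x L ih =>
      simp only [List.map_cons, List.sum_cons, map_add, mul_add]
      exact (norm_add_le _ _).trans (add_le_add (h x (h1 x (by simp)))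
        (ih fun y hy => h1 y (by simp [hy])))
  refine le_of_forall_pos_le_add fun ε hε => ?_
  obtain ⟨c, hc, hc'⟩ := Real.lt_sInf_add_pos (costs_nonempty r A)
    (div_pos hε (by linarith : 0 < C + 1))
  have h1 := key c hc
  have h2 : C * c ≤ C * (rNorm r A + ε / (C + 1)) :=
    mul_le_mul_of_nonneg_left hc'.le hC
  have h3 : C * (ε / (C + 1)) ≤ ε := by
    rw [← mul_div_assoc, div_le_iff₀ (by linarith)]
    nlinarith
  linarith [mul_add C (rNorm r A) (ε / (C + 1))]

theorem rNorm_smul_le (r : ℕ) (a : ℝ) (A : ℂ →₀ V) : rNorm r (a • A) ≤ |a| * rNorm r A := by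
  have key : ∀ c ∈ decompositionCosts r A, rNorm r (a • A) ≤ |a| * c := by
    rintro c ⟨L, h1, rfl, rfl⟩
    refine csInf_le (costs_bddBelow _ _)
      ⟨L.map fun x => ⟨x.dirs, x.base, a • x.vec⟩, ?_, ?_, ?_⟩
    · intro x hx
      obtain ⟨y, hy, rfl⟩ := List.mem_map.1 hx
      exact h1 y hy
    · rw [List.smul_sum, List.map_map, List.map_map]
      congr 1
      refine List.map_congr_left fun x _ => ?_
      simp [DiffTerm.chain, ← Finsupp.smul_single]
    · rw [← List.sum_map_mul_left, List.map_map]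
      congr 1
      refine List.map_congr_left fun x _ => ?_
      simp [DiffTerm.weight, norm_smul]
      ring
  refine le_of_forall_pos_le_add fun ε hε => ?_
  obtain ⟨c, hc, hc'⟩ := Real.lt_sInf_add_pos (costs_nonempty r A)
    (div_pos hε (by positivity : 0 < |a| + 1))
  have h1 := key c hc
  have h2 : |a| * c ≤ |a| * (rNorm r A + ε / (|a| + 1)) :=
    mul_le_mul_of_nonneg_left hc'.le (abs_nonneg a)
  have h3 : |a| * (ε / (|a| + 1)) ≤ ε := by
    rw [← mul_div_assoc, div_le_iff₀ (by positivity)]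
    nlinarith [abs_nonneg a]
  linarith [mul_add |a| (rNorm r A) (ε / (|a| + 1))]

/-- Pointed chains with values in `V`, carrying the `r`-norm. -/
def Pointed (V : Type) [NormedAddCommGroup V] [NormedSpace ℝ V] (_r : ℕ) : Type := ℂ →₀ V

noncomputable instance (r : ℕ) : AddCommGroup (Pointed V r) :=
  inferInstanceAs (AddCommGroup (ℂ →₀ V))

noncomputable instance (r : ℕ) : Module ℝ (Pointed V r) :=
  inferInstanceAs (Module ℝ (ℂ →₀ V))

noncomputable instance (r : ℕ) : SeminormedAddCommGroup (Pointed V r) :=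
  AddGroupSeminorm.toSeminormedAddCommGroup
    { toFun := fun A : Pointed V r => rNorm r A
      map_zero' := rNorm_zero r
      add_le' := rNorm_add_le r
      neg' := by
        have h : ∀ A : ℂ →₀ V, rNorm r (-A) ≤ rNorm r A := fun A => by
          simpa using rNorm_smul_le r (-1) A
        intro A
        refine le_antisymm (h A) ?_
        have h2 := h (-A)
        exact (congrArg (rNorm (V := V) r) (neg_neg (G := ℂ →₀ V) A)).symm.trans_le h2 }

theorem norm_pointed {r : ℕ} (A : Pointed V r) : ‖A‖ = rNorm r (V := V) A := rfl

noncomputable instance (r : ℕ) : NormedSpace ℝ (Pointed V r) where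
  norm_smul_le a A := rNorm_smul_le r a A

/-- The identity, from bare pointed chains to pointed chains with the `r`-norm. -/
noncomputable def toPointed (r : ℕ) : (ℂ →₀ V) →ₗ[ℝ] Pointed V r := LinearMap.id

/-- The identity, from pointed chains with the `r`-norm to bare pointed chains. -/
noncomputable def ofPointed (r : ℕ) : Pointed V r →ₗ[ℝ] (ℂ →₀ V) := LinearMap.id

/-- Differential chains of order `r` with values in `V`: the completion of pointed chains
with respect to the `r`-norm.  So `B̂_k^r(ℝ²)` is `Chain (Λᵏ) r`. -/
abbrev Chain (V : Type) [NormedAddCommGroup V] [NormedSpace ℝ V] (r : ℕ) : Type :=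
  UniformSpace.Completion (Pointed V r)

/-- A pointed chain as a differential chain of order `r`. -/
noncomputable def pointed (r : ℕ) (A : ℂ →₀ V) : Chain V r := (toPointed r A : Pointed V r)

/-- The continuous extension to `B̂^r` of a linear map on pointed chains that is bounded on
difference chains of order at most `r`. -/
noncomputable def extendChain {G : Type*} [NormedAddCommGroup G] [NormedSpace ℝ G]
    [CompleteSpace G] {r : ℕ} (T : (ℂ →₀ V) →ₗ[ℝ] G)
    (h : ∃ C, ∀ x : DiffTerm V, x.dirs.length ≤ r → ‖T x.chain‖ ≤ C * x.weight) :
    Chain V r →L[ℝ] G :=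
  ContinuousLinearMap.extend
    (LinearMap.mkContinuousOfExistsBound (T ∘ₗ ofPointed r) (by
      obtain ⟨C, hC⟩ := h
      refine ⟨max C 0, fun A => ?_⟩
      exact norm_le_of_terms (r := r) T (le_max_right C 0) (fun x hx => (hC x hx).trans
        (mul_le_mul_of_nonneg_right (le_max_left C 0) x.weight_nonneg)) A))
    (UniformSpace.Completion.toComplL (𝕜 := ℝ) (E := Pointed V r))

theorem extendChain_pointed {G : Type*} [NormedAddCommGroup G] [NormedSpace ℝ G]
    [CompleteSpace G] {r : ℕ} (T : (ℂ →₀ V) →ₗ[ℝ] G)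
    (h : ∃ C, ∀ x : DiffTerm V, x.dirs.length ≤ r → ‖T x.chain‖ ≤ C * x.weight)
    (A : ℂ →₀ V) : extendChain T h (pointed r A) = T A :=
  ContinuousLinearMap.extend_eq _
    (UniformSpace.Completion.denseRange_coe (α := Pointed V r))
    (UniformSpace.Completion.isUniformInducing_coe (Pointed V r)) (toPointed r A)

/-- `pointed r` as a linear map. -/
noncomputable def pointedL (r : ℕ) : (ℂ →₀ V) →ₗ[ℝ] Chain V r :=
  (UniformSpace.Completion.toComplL (𝕜 := ℝ) (E := Pointed V r)).toLinearMap ∘ₗ toPointed r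

theorem norm_pointedL (r : ℕ) (A : ℂ →₀ V) : ‖pointedL r A‖ = rNorm r A :=
  UniformSpace.Completion.norm_coe (E := Pointed V r) (toPointed r A)

/-- The canonical map `φ_{r,r+1} : B̂^r → B̂^{r+1}` extending the identity of pointed chains. -/
noncomputable def inclusion (r : ℕ) : Chain V r →L[ℝ] Chain V (r + 1) :=
  extendChain (pointedL (r + 1)) ⟨1, fun x hx => by
    rw [norm_pointedL, one_mul]
    exact rNorm_term_le x (hx.trans r.le_succ)⟩

end Pointed

section Forms

variable {V F : Type} [NormedAddCommGroup V] [NormedSpace ℝ V]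
  [NormedAddCommGroup F] [NormedSpace ℝ F]

/-- Evaluation `ω(A) = ∑ ω_p(α)` of an `F`-valued form (`F = ℝ` or `ℂ`) on `A = ∑ (p; α)`. -/
noncomputable def formEval (ω : ℂ → V →ₗ[ℝ] F) : (ℂ →₀ V) →ₗ[ℝ] F := Finsupp.lsum ℝ ω

/-- `ω ∈ B^r`, i.e. `‖ω‖_{B^r} < ∞`: `|ω(Δ_U^j(p;α))| ≤ C |Δ_U^j(p;α)|_j` for all `j ≤ r`. -/
def IsBForm (r : ℕ) (ω : ℂ → V →ₗ[ℝ] F) : Prop :=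
  ∃ C : ℝ, ∀ x : DiffTerm V, x.dirs.length ≤ r → ‖formEval ω x.chain‖ ≤ C * x.weight

/-- A form in `B^r` as a continuous functional on `B̂^r`; its value at `J` is the Harrison
integral of `ω` over `J`. -/
noncomputable def IsBForm.integral [CompleteSpace F] {r : ℕ} {ω : ℂ → V →ₗ[ℝ] F}
    (h : IsBForm r ω) : Chain V r →L[ℝ] F :=
  extendChain (formEval ω) h

/-- `X` supports `J`: for every non-empty open `W ⊇ X`, `J` is a limit in `B̂^r` of pointed
chains in `W`. -/
def SupportedBy {r : ℕ} (J : Chain V r) (X : Set ℂ) : Prop :=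
  ∀ W : Set ℂ, IsOpen W → W.Nonempty → X ⊆ W →
    ∃ A : ℕ → (ℂ →₀ V), (∀ i, ((A i).support : Set ℂ) ⊆ W) ∧
      Tendsto (fun i => pointed r (A i)) atTop (𝓝 J)

/-- The support of a chain: the intersection of all closed sets supporting it. -/
def chainSupport {r : ℕ} (J : Chain V r) : Set ℂ :=
  ⋂₀ {X | IsClosed X ∧ SupportedBy J X}

/-- `c` is the Harrison integral over `J` of the form `ω`, defined near `supp J` only: some
`η ∈ B^r` coincides with `ω` on a neighbourhood of `supp J`, and every such `η` has
integral `c` over `J`. -/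
def HasHarrisonIntegral [CompleteSpace F] {r : ℕ} (J : Chain V r) (ω : ℂ → V →ₗ[ℝ] F)
    (c : F) : Prop :=
  (∃ η : ℂ → V →ₗ[ℝ] F, IsBForm r η ∧ ∀ᶠ w in 𝓝ˢ (chainSupport J), η w = ω w) ∧
  ∀ (η : ℂ → V →ₗ[ℝ] F) (hη : IsBForm r η),
    (∀ᶠ w in 𝓝ˢ (chainSupport J), η w = ω w) → hη.integral J = c

/-- The Harrison integral of `ω` over `J` is well-defined. -/
def HarrisonIntegrable [CompleteSpace F] {r : ℕ} (J : Chain V r) (ω : ℂ → V →ₗ[ℝ] F) : Prop :=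
  ∃ c, HasHarrisonIntegral J ω c

open Classical in
/-- The Harrison integral of `ω` over `J` (zero if it is not well-defined). -/
noncomputable def harrisonIntegral [CompleteSpace F] {r : ℕ} (J : Chain V r)
    (ω : ℂ → V →ₗ[ℝ] F) : F :=
  if h : HarrisonIntegrable J ω then h.choose else 0

theorem HasHarrisonIntegral.eq [CompleteSpace F] {r : ℕ} {J : Chain V r} {ω : ℂ → V →ₗ[ℝ] F}
    {c : F} (h : HasHarrisonIntegral J ω c) : harrisonIntegral J ω = c := by
  have h' : HarrisonIntegrable J ω := ⟨c, h⟩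
  obtain ⟨η, hη, hηω⟩ := h.1
  rw [harrisonIntegral, dif_pos h', ← h.2 η hη hηω, ← h'.choose_spec.2 η hη hηω]

/-- The mass of a chain: `inf { liminf ‖A_i‖_{B⁰} : A_i → K, A_i pointed }`. -/
noncomputable def mass {r : ℕ} (K : Chain V r) : ℝ≥0∞ :=
  ⨅ (A : ℕ → (ℂ →₀ V)) (_ : Tendsto (fun i => pointed r (A i)) atTop (𝓝 K)),
    liminf (fun i => ENNReal.ofReal (rNorm 0 (A i))) atTop

/-- The complex `1`-form `g(w) dw`. -/
noncomputable def dwForm (g : ℂ → ℂ) : ℂ → ℂ →ₗ[ℝ] ℂ := fun w => LinearMap.mulLeft ℝ (g w)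

/-- The winding number `Ind_J(z) = (1/2πi) ∫_J dw/(w-z)` of a `1`-chain. -/
noncomputable def windingNumber {r : ℕ} (J : Chain ℂ r) (z : ℂ) : ℂ :=
  1 / (2 * Real.pi * Complex.I) * harrisonIntegral J (dwForm fun w => 1 / (w - z))

end Forms

section Boundary

variable {V W : Type} [NormedAddCommGroup V] [NormedSpace ℝ V]
  [NormedAddCommGroup W] [NormedSpace ℝ W]

theorem difference_single (u p : ℂ) (α : V) :
    difference u (single p α) = single (p + u) α - single p α := by
  simp [difference, translate]

theorem difference_comm (u v : ℂ) (A : ℂ →₀ V) :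
    difference u (difference v A) = difference v (difference u A) := by
  induction A using Finsupp.induction_linear with
  | zero => simp
  | add f g hf hg => simp [hf, hg]
  | single p α =>
    simp only [difference_single, map_sub, add_right_comm p u v]
    abel

theorem difference_add (u v : ℂ) (A : ℂ →₀ V) :
    difference (u + v) A - difference u A - difference v A = difference u (difference v A) := by
  induction A using Finsupp.induction_linear with
  | zero => simp
  | add f g hf hg =>
    simp only [map_add, ← hf, ← hg]
    abel
  | single p α =>
    simp only [difference_single, map_sub, add_right_comm p u v, ← add_assoc]
    abel

theorem rNorm_difference_le (r : ℕ) (u : ℂ) (A : ℂ →₀ V) :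
    rNorm (r + 1) (difference u A) ≤ ‖u‖ * rNorm r A := by
  rw [← norm_pointedL]
  refine norm_le_of_terms (r := r) (pointedL (r + 1) ∘ₗ difference u) (norm_nonneg u) ?_ A
  intro x hx
  have h := rNorm_term_le (r := r + 1) (⟨u :: x.dirs, x.base, x.vec⟩ : DiffTerm V)
    (by simpa using hx)
  have h2 : (⟨u :: x.dirs, x.base, x.vec⟩ : DiffTerm V).weight = ‖u‖ * x.weight := by
    simp [DiffTerm.weight, mul_assoc]
  rw [h2] at h
  exact (norm_pointedL (r + 1) (difference u x.chain)).trans_le h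

/-- A function that is additive up to a second-order error has a derivative at `0`. -/
theorem exists_deriv_of_almost_additive {G : Type*} [NormedAddCommGroup G] [NormedSpace ℝ G]
    [CompleteSpace G] (d : ℝ → G) (M N : ℝ)
    (hM : ∀ s t, ‖d (s + t) - d s - d t‖ ≤ M * |s| * |t|) (hN : ∀ t, ‖d t‖ ≤ N * |t|) :
    ∃ L, Tendsto (fun t : ℝ => t⁻¹ • d t) (𝓝[≠] 0) (𝓝 L) := by
  have step : ∀ (t : ℝ) (n : ℕ), dist ((2 : ℝ) ^ n • d (t / 2 ^ n))
      ((2 : ℝ) ^ (n + 1) • d (t / 2 ^ (n + 1))) ≤ (M * t ^ 2 / 2) / 2 / 2 ^ n := by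
    intro t n
    have h := hM (t / 2 ^ (n + 1)) (t / 2 ^ (n + 1))
    have e1 : t / 2 ^ (n + 1) + t / 2 ^ (n + 1) = t / 2 ^ n := by
      field_simp
      ring
    rw [e1] at h
    have e2 : (2 : ℝ) ^ n • d (t / 2 ^ n) - (2 : ℝ) ^ (n + 1) • d (t / 2 ^ (n + 1))
        = (2 : ℝ) ^ n • (d (t / 2 ^ n) - d (t / 2 ^ (n + 1)) - d (t / 2 ^ (n + 1))) := by
      rw [pow_succ, mul_smul, ← smul_sub, two_smul]
      congr 1
      abel
    rw [dist_eq_norm, e2, norm_smul, Real.norm_of_nonneg (by positivity)]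
    refine (mul_le_mul_of_nonneg_left h (by positivity)).trans (le_of_eq ?_)
    rw [mul_assoc M, abs_mul_abs_self]
    field_simp
    ring
  have hlim : ∀ t, ∃ l, Tendsto (fun n : ℕ => (2 : ℝ) ^ n • d (t / 2 ^ n)) atTop (𝓝 l) :=
    fun t => cauchySeq_tendsto_of_complete (cauchySeq_of_le_geometric_two (step t))
  choose l hl using hlim
  have hd : ∀ t, ‖d t - l t‖ ≤ M * t ^ 2 / 2 := by
    intro t
    have := dist_le_of_le_geometric_two_of_tendsto₀ (step t) (hl t)
    simpa [dist_eq_norm] using this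
  have hadd : ∀ s t, l (s + t) = l s + l t := by
    intro s t
    have h1 : Tendsto (fun n : ℕ => (2 : ℝ) ^ n • d ((s + t) / 2 ^ n)
        - (2 : ℝ) ^ n • d (s / 2 ^ n) - (2 : ℝ) ^ n • d (t / 2 ^ n)) atTop
        (𝓝 (l (s + t) - l s - l t)) := ((hl (s + t)).sub (hl s)).sub (hl t)
    have h2 : Tendsto (fun n : ℕ => (2 : ℝ) ^ n • d ((s + t) / 2 ^ n)
        - (2 : ℝ) ^ n • d (s / 2 ^ n) - (2 : ℝ) ^ n • d (t / 2 ^ n)) atTop (𝓝 0) := by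
      have h3 : Tendsto (fun n : ℕ => M * |s| * |t| * (1 / 2 : ℝ) ^ n) atTop (𝓝 0) := by
        simpa using (tendsto_pow_atTop_nhds_zero_of_lt_one (by norm_num : (0 : ℝ) ≤ 1 / 2)
          (by norm_num)).const_mul (M * |s| * |t|)
      refine squeeze_zero_norm (fun n => ?_) h3
      rw [← smul_sub, ← smul_sub, norm_smul, Real.norm_of_nonneg (by positivity), add_div]
      refine (mul_le_mul_of_nonneg_left (hM _ _) (by positivity)).trans (le_of_eq ?_)
      rw [abs_div, abs_div, abs_of_pos (by positivity : (0 : ℝ) < 2 ^ n), one_div, inv_pow]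
      field_simp
    have := tendsto_nhds_unique h1 h2
    rw [sub_sub, sub_eq_zero] at this
    exact this
  have hlb : ∀ t, ‖l t‖ ≤ N * |t| := by
    intro t
    refine le_of_tendsto (hl t).norm (Eventually.of_forall fun n => ?_)
    rw [norm_smul, Real.norm_of_nonneg (by positivity)]
    refine (mul_le_mul_of_nonneg_left (hN _) (by positivity)).trans (le_of_eq ?_)
    rw [abs_div, abs_of_pos (by positivity : (0 : ℝ) < 2 ^ n)]
    field_simp
  let φ : ℝ →+ G := AddMonoidHom.mk' l hadd
  have hcont : Continuous φ := by
    refine AddMonoidHomClass.continuous_of_bound φ N fun x => ?_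
    exact hlb x
  have hlin : ∀ t : ℝ, l t = t • l 1 := by
    intro t
    have := map_real_smul φ hcont t 1
    simpa [φ] using this
  refine ⟨l 1, ?_⟩
  rw [tendsto_iff_norm_sub_tendsto_zero]
  have h0 : Tendsto (fun t : ℝ => M / 2 * |t|) (𝓝[≠] 0) (𝓝 0) := by
    have : Tendsto (fun t : ℝ => M / 2 * |t|) (𝓝 0) (𝓝 (M / 2 * |0|)) :=
      (continuous_const.mul continuous_abs).tendsto 0
    simpa using this.mono_left nhdsWithin_le_nhds
  refine squeeze_zero' (Eventually.of_forall fun _ => norm_nonneg _) ?_ h0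
  filter_upwards [self_mem_nhdsWithin] with t ht
  have ht : t ≠ 0 := ht
  have e : t⁻¹ • d t - l 1 = t⁻¹ • (d t - l t) := by
    rw [smul_sub, hlin t, inv_smul_smul₀ ht]
  rw [e, norm_smul, norm_inv, Real.norm_eq_abs]
  refine (mul_le_mul_of_nonneg_left (hd t) (by positivity)).trans (le_of_eq ?_)
  rw [← sq_abs t]
  field_simp

theorem exists_prederivative (r : ℕ) (v : ℂ) (A : ℂ →₀ V) :
    ∃ L, Tendsto (fun t : ℝ => t⁻¹ • pointed (r + 2) (difference ((t : ℂ) * v) A))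
      (𝓝[≠] 0) (𝓝 L) := by
  refine exists_deriv_of_almost_additive
    (fun t : ℝ => pointed (r + 2) (difference ((t : ℂ) * v) A))
    (‖v‖ * ‖v‖ * rNorm r A) (‖v‖ * rNorm (r + 1) A) ?_ ?_
  · intro s t
    have e : pointed (r + 2) (difference (((s + t : ℝ) : ℂ) * v) A)
        - pointed (r + 2) (difference ((s : ℂ) * v) A)
        - pointed (r + 2) (difference ((t : ℂ) * v) A)
        = pointedL (r + 2) (difference ((s : ℂ) * v) (difference ((t : ℂ) * v) A)) := by
      rw [← difference_add, map_sub, map_sub, ← add_mul, ← Complex.ofReal_add]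
      rfl
    simp only [e, norm_pointedL]
    refine (rNorm_difference_le _ _ _).trans ?_
    refine (mul_le_mul_of_nonneg_left (rNorm_difference_le _ _ _) (norm_nonneg _)).trans
      (le_of_eq ?_)
    simp only [norm_mul, Complex.norm_real, Real.norm_eq_abs]
    ring
  · intro t
    refine (norm_pointedL (r + 2) _).trans_le ((rNorm_difference_le _ _ _).trans (le_of_eq ?_))
    simp only [norm_mul, Complex.norm_real, Real.norm_eq_abs]
    ring

/-- The prederivative of a pointed chain,
`P_v A = lim_{t → 0} ((T_{tv} A - A) / t)`, the limit being taken in `B̂^{r+2}`. -/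
noncomputable def prederivPointed (r : ℕ) (v : ℂ) (A : ℂ →₀ V) : Chain V (r + 2) :=
  limUnder (𝓝[≠] (0 : ℝ))
    (fun t : ℝ => t⁻¹ • pointed (r + 2) (difference ((t : ℂ) * v) A))

theorem tendsto_prederivPointed (r : ℕ) (v : ℂ) (A : ℂ →₀ V) :
    Tendsto (fun t : ℝ => t⁻¹ • pointed (r + 2) (difference ((t : ℂ) * v) A))
      (𝓝[≠] 0) (𝓝 (prederivPointed r v A)) :=
  tendsto_nhds_limUnder (exists_prederivative r v A)

/-- The prederivative on pointed chains as a linear map. -/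
noncomputable def prederivL (r : ℕ) (v : ℂ) : (ℂ →₀ V) →ₗ[ℝ] Chain V (r + 2) where
  toFun := prederivPointed r v
  map_add' A B := by
    refine tendsto_nhds_unique (tendsto_prederivPointed r v (A + B))
      (((tendsto_prederivPointed r v A).add (tendsto_prederivPointed r v B)).congr fun t => ?_)
    rw [← smul_add]
    congr 1
    rw [map_add]
    exact ((pointedL (r + 2)).map_add _ _).symm
  map_smul' a A := by
    refine tendsto_nhds_unique (tendsto_prederivPointed r v (a • A))
      (((tendsto_prederivPointed r v A).const_smul a).congr fun t => ?_)
    rw [smul_comm, map_smul]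
    congr 1
    exact ((pointedL (r + 2)).map_smul a _).symm

/-- The prederivative `P_v : B̂^{r+1} → B̂^{r+2}`. -/
noncomputable def prederivative (r : ℕ) (v : ℂ) : Chain V (r + 1) →L[ℝ] Chain V (r + 2) :=
  extendChain (prederivL r v) ⟨‖v‖, fun x hx => by
    refine le_of_tendsto (tendsto_prederivPointed r v x.chain).norm ?_
    filter_upwards [self_mem_nhdsWithin] with t ht
    have ht : t ≠ 0 := ht
    have h : ‖pointed (r + 2) (difference ((t : ℂ) * v) x.chain)‖ ≤ ‖(t : ℂ) * v‖ * x.weight :=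
      (norm_pointedL (r + 2) _).trans_le ((rNorm_difference_le _ _ _).trans
        (mul_le_mul_of_nonneg_left (rNorm_term_le x hx) (norm_nonneg _)))
    rw [norm_smul, norm_inv, Real.norm_eq_abs]
    refine (mul_le_mul_of_nonneg_left h (by positivity)).trans (le_of_eq ?_)
    rw [norm_mul, Complex.norm_real, Real.norm_eq_abs]
    field_simp⟩

/-- Applying a linear map of the fibres to the coefficients of a pointed chain. -/
noncomputable def mapCoeff (E : V →L[ℝ] W) : (ℂ →₀ V) →ₗ[ℝ] (ℂ →₀ W) :=
  Finsupp.mapRange.linearMap E.toLinearMap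

theorem mapCoeff_single (E : V →L[ℝ] W) (p : ℂ) (α : V) :
    mapCoeff E (single p α) = single p (E α) := by
  simp [mapCoeff]

theorem mapCoeff_iterDifference (E : V →L[ℝ] W) (U : List ℂ) (A : ℂ →₀ V) :
    mapCoeff E (iterDifference U A) = iterDifference U (mapCoeff E A) := by
  have h1 : ∀ (u : ℂ) (B : ℂ →₀ V),
      mapCoeff E (difference u B) = difference u (mapCoeff E B) := by
    intro u B
    induction B using Finsupp.induction_linear with
    | zero => simp
    | add f g hf hg => simp [hf, hg]
    | single p α => simp only [difference_single, map_sub, mapCoeff_single]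
  induction U with
  | nil => rfl
  | cons u U ih => simp [iterDifference, h1, ih]

/-- The extension to `B̂^r` of a linear map of the fibres. -/
noncomputable def mapChain (r : ℕ) (E : V →L[ℝ] W) : Chain V r →L[ℝ] Chain W r :=
  extendChain (pointedL r ∘ₗ mapCoeff E) ⟨‖E‖, fun x hx => by
    have e : mapCoeff E x.chain = (⟨x.dirs, x.base, E x.vec⟩ : DiffTerm W).chain := by
      simp only [DiffTerm.chain, mapCoeff_iterDifference, mapCoeff_single]
    refine (norm_pointedL r (mapCoeff E x.chain)).trans_le ?_
    rw [e]
    refine (rNorm_term_le (⟨x.dirs, x.base, E x.vec⟩ : DiffTerm W) hx).trans ?_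
    have hp : 0 ≤ (x.dirs.map (fun u => ‖u‖)).prod := List.prod_nonneg (by
      intro a ha
      obtain ⟨u, -, rfl⟩ := List.mem_map.1 ha
      exact norm_nonneg u)
    refine (mul_le_mul_of_nonneg_left (E.le_opNorm x.vec) hp).trans (le_of_eq ?_)
    simp only [DiffTerm.weight]
    ring⟩

/-- The coordinate of `v ∧ w ∈ Λ²ℝ²` with respect to `e₁ ∧ e₂`. -/
def wedge (v w : ℂ) : ℝ := v.re * w.im - v.im * w.re

/-- Retraction `E_v† : Λ¹ → Λ⁰`, `w ↦ ⟨v, w⟩`. -/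
noncomputable def retract₁ (v : ℂ) : ℂ →L[ℝ] ℝ := innerSL ℝ v

/-- Retraction `E_v† : Λ² → Λ¹`,
`a e₁ ∧ e₂ ↦ a (⟨v, e₁⟩ e₂ - ⟨v, e₂⟩ e₁) = a (v.re I - v.im)`. -/
noncomputable def retract₂ (v : ℂ) : ℝ →L[ℝ] ℂ :=
  ContinuousLinearMap.toSpanSingleton ℝ ((v.re : ℂ) * Complex.I - (v.im : ℂ))

theorem retract₂_wedge (v a b : ℂ) :
    retract₂ v (wedge a b) = (inner ℝ v a : ℝ) • b - (inner ℝ v b : ℝ) • a := by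
  apply Complex.ext <;>
    simp [retract₂, wedge, Complex.inner, ContinuousLinearMap.toSpanSingleton_apply] <;> ring

/-- Boundary `∂ = ∑ᵢ P_{eᵢ} ∘ E_{eᵢ}† : B̂_1^{r+1} → B̂_0^{r+2}`. -/
noncomputable def boundary₁ (r : ℕ) : Chain ℂ (r + 1) →L[ℝ] Chain ℝ (r + 2) :=
  (prederivative r 1) ∘L (mapChain (r + 1) (retract₁ 1)) +
    (prederivative r Complex.I) ∘L (mapChain (r + 1) (retract₁ Complex.I))

/-- Boundary `∂ = ∑ᵢ P_{eᵢ} ∘ E_{eᵢ}† : B̂_2^{r+1} → B̂_1^{r+2}`. -/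
noncomputable def boundary₂ (r : ℕ) : Chain ℝ (r + 1) →L[ℝ] Chain ℂ (r + 2) :=
  (prederivative r 1) ∘L (mapChain (r + 1) (retract₂ 1)) +
    (prederivative r Complex.I) ∘L (mapChain (r + 1) (retract₂ Complex.I))

/-- `∂K = J` for `K ∈ B̂_2^r` and `J ∈ B̂_1^{r+1}`.  The prederivative of a chain of order `0`
only exists in order `2`, so the equation is read in `B̂_1^{r+2}`, through the canonical
(injective) maps; this makes sense for every `r ≥ 0`. -/
def IsBoundaryOf {r : ℕ} (J : Chain ℂ (r + 1)) (K : Chain ℝ r) : Prop :=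
  boundary₂ r (inclusion r K) = inclusion (r + 1) J

end Boundary

end DifferentialChains

/-! Since `(f w - f z) / (w - z)` extends to the function `dslope f z`, holomorphic on `U`, the
formula reduces to Cauchy's theorem `hasHarrisonIntegral_eq_zero`: `∫_J F dw = 0` for every `F`
holomorphic on `U`.

Cauchy's theorem comes from the Cauchy–Pompeiu formula. Let `Z` be the set of points off `supp J`
about which `J` has winding number zero. It contains the complement of `U`, and it is open: for `ζ'`
near `ζ` the form `dw/(w-ζ) - dw/(w-ζ')` has a logarithmic primitive near `supp J`, so Stokes and
`∂J = 0` make its integral vanish. Hence `Zᶜ` is compact in `U`, and `F` can be cut off to a smooth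
`g` with compact support in `U` and `g = F` near `Zᶜ`, in particular near `supp J`. Then `∂g/∂z̄` is
supported in `Z`, and `F` is near `supp J` a superposition of Cauchy kernels `1/(w-ζ)` with `ζ ∈ Z`,
each of integral zero over `J`. Exchanging the two integrations (`integral_superposition_eq_zero`)
gives the claim.

Integrals are well-defined because a form in `B^r` that vanishes near `supp J` integrates to zero
(`IsBForm.integral_eq_zero`). This needs an argument: `supp J` is an intersection of supporting sets
and is not known to support `J` itself. -/

open scoped ContDiff

namespace DifferentialChains

/-! ### Bounds on iterated differences of functions -/

section DiffBound

variable {E G : Type} [NormedAddCommGroup E] [NormedAddCommGroup G]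

/-- All iterated differences of `g` of order `j ≤ n` satisfy `‖Δ_U^j g‖ ≤ C ‖u₁‖ ⋯ ‖u_j‖`. -/
def DiffBound : ℕ → ℝ → (ℂ → E) → Prop
  | 0, C, g => ∀ p, ‖g p‖ ≤ C
  | n + 1, C, g => (∀ p, ‖g p‖ ≤ C) ∧ ∀ u, DiffBound n (C * ‖u‖) fun p => g (p + u) - g p

namespace DiffBound

theorem norm_le {n : ℕ} {C : ℝ} {g : ℂ → E} (h : DiffBound n C g) (p : ℂ) : ‖g p‖ ≤ C := by
  cases n with
  | zero => exact h p
  | succ n => exact h.1 p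

theorem nonneg {n : ℕ} {C : ℝ} {g : ℂ → E} (h : DiffBound n C g) : 0 ≤ C :=
  (norm_nonneg _).trans (h.norm_le 0)

theorem mono {n : ℕ} {C C' : ℝ} {g : ℂ → E} (h : DiffBound n C g) (hC : C ≤ C') :
    DiffBound n C' g := by
  induction n generalizing C C' g with
  | zero => exact fun p => (h p).trans hC
  | succ n ih =>
    exact ⟨fun p => (h.1 p).trans hC, fun u => ih (h.2 u) (by gcongr)⟩

theorem congr' {n : ℕ} {C C' : ℝ} {g g' : ℂ → E} (h : DiffBound n C g) (hC : C = C')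
    (hg : ∀ p, g p = g' p) : DiffBound n C' g' := by
  obtain rfl : g = g' := funext hg
  exact hC ▸ h

theorem of_succ {n : ℕ} {C : ℝ} {g : ℂ → E} (h : DiffBound (n + 1) C g) : DiffBound n C g := by
  induction n generalizing C g with
  | zero => exact h.1
  | succ n ih => exact ⟨h.1, fun u => ih (h.2 u)⟩

theorem add {n : ℕ} {a b : ℝ} {f g : ℂ → E} (hf : DiffBound n a f) (hg : DiffBound n b g) :
    DiffBound n (a + b) (fun p => f p + g p) := by
  induction n generalizing a b f g with
  | zero => exact fun p => norm_add_le_of_le (hf p) (hg p)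
  | succ n ih =>
    refine ⟨fun p => norm_add_le_of_le (hf.1 p) (hg.1 p), fun u => ?_⟩
    exact (ih (hf.2 u) (hg.2 u)).congr' (by ring) fun p => by simp only []; abel

theorem clm_comp [NormedSpace ℝ E] [NormedSpace ℝ G] (T : E →L[ℝ] G) {n : ℕ} {C : ℝ}
    {g : ℂ → E} (h : DiffBound n C g) : DiffBound n (‖T‖ * C) (fun p => T (g p)) := by
  induction n generalizing C g with
  | zero => exact fun p => T.le_opNorm_of_le (h p)
  | succ n ih =>
    refine ⟨fun p => T.le_opNorm_of_le (h.1 p), fun u => ?_⟩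
    exact (ih (h.2 u)).congr' (by ring) fun p => by simp

theorem comp_add_right {n : ℕ} {C : ℝ} {g : ℂ → E} (h : DiffBound n C g) (v : ℂ) :
    DiffBound n C (fun p => g (p + v)) := by
  induction n generalizing C g with
  | zero => exact fun p => h _
  | succ n ih =>
    refine ⟨fun p => h.1 _, fun u => ?_⟩
    convert ih (h.2 u) using 4
    ring

/-- Contracting the variable only shortens the increments. This makes the bounds for the cutoffs `χ
(w / R)` uniform in `R ≥ 1`. -/
theorem comp_mul_left {n : ℕ} {C : ℝ} {g : ℂ → E} (h : DiffBound n C g) {c : ℂ} (hc : ‖c‖ ≤ 1) :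
    DiffBound n C (fun p => g (c * p)) := by
  induction n generalizing C g with
  | zero => exact fun p => h _
  | succ n ih =>
    refine ⟨fun p => h.1 _, fun u => ?_⟩
    have h1 := ih (h.2 (c * u))
    have h2 := h1.mono (C' := C * ‖u‖) (by
      rw [norm_mul]
      exact mul_le_mul_of_nonneg_left (mul_le_of_le_one_left (norm_nonneg u) hc) h.nonneg)
    convert h2 using 4
    ring

/-- Leibniz rule `Δ_u (f g) = (Δ_u f) · g(· + u) + f · Δ_u g`: every difference doubles the number
of terms, whence the factor `2 ^ n`. -/
theorem smul {𝕜 : Type} [NormedField 𝕜] [NormedSpace 𝕜 E] {n : ℕ} {a b : ℝ} {f : ℂ → 𝕜}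
    {g : ℂ → E} (hf : DiffBound n a f) (hg : DiffBound n b g) :
    DiffBound n (2 ^ n * (a * b)) (fun p => f p • g p) := by
  have key : ∀ {n : ℕ} {a b : ℝ} {f : ℂ → 𝕜} {g : ℂ → E}, DiffBound n a f → DiffBound n b g →
      ∀ p, ‖f p • g p‖ ≤ a * b := fun hf hg p => by
    rw [norm_smul]
    exact mul_le_mul (hf.norm_le p) (hg.norm_le p) (norm_nonneg _) hf.nonneg
  induction n generalizing a b f g with
  | zero => simpa [DiffBound] using key hf hg
  | succ n ih =>
    refine ⟨fun p => (key hf hg p).trans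
      (le_mul_of_one_le_left (mul_nonneg hf.nonneg hg.nonneg) (one_le_pow₀ one_le_two)),
      fun u => ?_⟩
    exact ((ih (hf.2 u) (hg.of_succ.comp_add_right u)).add (ih hf.of_succ (hg.2 u))).congr'
      (by ring) fun p => by
        simp only [sub_smul, smul_sub]
        abel

theorem integral_smul [NormedSpace ℝ E] [NormedSpace ℂ E] {n : ℕ} {C : ℝ} {a : ℂ → ℂ}
    {g : ℂ → ℂ → E} (hg : ∀ ζ, DiffBound n C (g ζ)) (ha : MeasureTheory.Integrable a)
    (hi : ∀ p, MeasureTheory.Integrable fun ζ => a ζ • g ζ p) :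
    DiffBound n ((∫ ζ, ‖a ζ‖) * C) (fun p => ∫ ζ, a ζ • g ζ p) := by
  have key : ∀ {n : ℕ} {C : ℝ} {g : ℂ → ℂ → E}, (∀ ζ, DiffBound n C (g ζ)) →
      ∀ p, ‖∫ ζ, a ζ • g ζ p‖ ≤ (∫ ζ, ‖a ζ‖) * C := by
    intro n C g hg p
    rw [← MeasureTheory.integral_mul_const]
    refine MeasureTheory.norm_integral_le_of_norm_le (ha.norm.mul_const C)
      (Eventually.of_forall fun ζ => ?_)
    rw [norm_smul]
    exact mul_le_mul_of_nonneg_left ((hg ζ).norm_le p) (norm_nonneg _)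
  induction n generalizing C g with
  | zero => exact key hg
  | succ n ih =>
    refine ⟨key hg, fun u => ?_⟩
    refine (ih (fun ζ => (hg ζ).2 u) (fun p => ?_)).congr' (by ring) fun p => ?_
    · simp only [smul_sub]
      exact (hi (p + u)).sub (hi p)
    · simp only [smul_sub]
      exact MeasureTheory.integral_sub (hi _) (hi _)

/-- The mean value inequality turns a bound on the derivative into one factor `‖u‖`; since
differences commute with `fderiv`, induction gives the higher orders. -/
theorem difference_of_fderiv [NormedSpace ℝ E] {n : ℕ} {C : ℝ} {g : ℂ → E}
    (hd : Differentiable ℝ g) (h : DiffBound n C (fderiv ℝ g)) (u : ℂ) :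
    DiffBound n (C * ‖u‖) (fun p => g (p + u) - g p) := by
  have key : ∀ {n : ℕ} {C : ℝ} {g : ℂ → E}, Differentiable ℝ g → DiffBound n C (fderiv ℝ g) →
      ∀ p, ‖g (p + u) - g p‖ ≤ C * ‖u‖ := by
    intro n C g hd h p
    have := convex_univ.norm_image_sub_le_of_norm_fderiv_le (𝕜 := ℝ) (f := g) (C := C)
      (fun x _ => hd x) (fun x _ => h.norm_le x) (Set.mem_univ p) (Set.mem_univ (p + u))
    simpa using this
  induction n generalizing C g with
  | zero => exact key hd h
  | succ n ih =>
    refine ⟨key hd h, fun v => ?_⟩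
    have hdv : Differentiable ℝ (fun p => g (p + v)) := hd.comp (differentiable_id.add_const v)
    have e : fderiv ℝ (fun p => g (p + v) - g p) = fun p => fderiv ℝ g (p + v) - fderiv ℝ g p := by
      funext p
      rw [fderiv_fun_sub (hdv p) (hd p), fderiv_comp_add_right]
    have h1 := ih (g := fun p => g (p + v) - g p) (hdv.sub hd) (by simpa only [← e] using h.2 v)
    refine h1.congr' (by ring) fun p => ?_
    simp only [add_right_comm _ u v]
    abel

end DiffBound

/-- The induction varies the target space, because its step passes from `g` to `fderiv ℝ g`, again
smooth with compact support. -/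
theorem exists_diffBound (n : ℕ) {E : Type} [NormedAddCommGroup E] [NormedSpace ℝ E] {g : ℂ → E}
    (hg : ContDiff ℝ ∞ g) (hc : HasCompactSupport g) : ∃ C, DiffBound n C g := by
  induction n generalizing E g with
  | zero =>
    obtain ⟨C, hC⟩ := hc.exists_bound_of_continuous hg.continuous
    exact ⟨C, hC⟩
  | succ n ih =>
    obtain ⟨C, hC⟩ := hc.exists_bound_of_continuous hg.continuous
    obtain ⟨C', hC'⟩ := ih (hg.fderiv_right (m := ∞) (by simp)) (hc.fderiv (𝕜 := ℝ))
    refine ⟨max C C', fun p => (hC p).trans (le_max_left _ _), fun u => ?_⟩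
    exact (DiffBound.difference_of_fderiv (hg.differentiable (by simp)) hC' u).mono (by gcongr; exact le_max_right _ _)

end DiffBound

/-! ### Forms in `B^r` through their coefficients -/

section Forms

variable {V F : Type} [NormedAddCommGroup V] [NormedSpace ℝ V]
  [NormedAddCommGroup F] [NormedSpace ℝ F]

theorem formEval_single (η : ℂ → V →ₗ[ℝ] F) (p : ℂ) (α : V) :
    formEval η (single p α) = η p α := by
  simp [formEval]

theorem formEval_difference (η : ℂ → V →ₗ[ℝ] F) (u : ℂ) (A : ℂ →₀ V) :
    formEval η (difference u A) = formEval (fun p => η (p + u) - η p) A := by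
  induction A using Finsupp.induction_linear with
  | zero => simp
  | add f g hf hg => simp [hf, hg]
  | single p α => simp [difference_single, formEval_single]

/-- By `formEval_difference`, a difference of chains can be moved onto the form; estimates on
difference chains thus become estimates on ordinary functions, one for each fixed vector `α`. -/
theorem norm_formEval_chain_le_iff {r : ℕ} {C : ℝ} {η : ℂ → V →ₗ[ℝ] F} :
    (∀ x : DiffTerm V, x.dirs.length ≤ r → ‖formEval η x.chain‖ ≤ C * x.weight) ↔
      ∀ α, DiffBound r (C * ‖α‖) fun p => η p α := by
  have comm : ∀ (u : ℂ) (U : List ℂ) (A : ℂ →₀ V),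
      difference u (iterDifference U A) = iterDifference U (difference u A) := by
    intro u U A
    induction U with
    | nil => rfl
    | cons v U ih => simp [iterDifference, difference_comm u v, ih]
  constructor
  · intro h α
    have h' : ∀ (U : List ℂ) (p : ℂ), U.length ≤ r →
        ‖formEval η (iterDifference U (single p α))‖ ≤
          C * ‖α‖ * (U.map fun u => ‖u‖).prod := fun U p hU => by
      refine (h ⟨U, p, α⟩ hU).trans (le_of_eq ?_)
      simp only [DiffTerm.weight]
      ring
    clear h
    -- The constant must be free, as each difference multiplies it by `‖u‖`.
    generalize C * ‖α‖ = D at h'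
    induction r generalizing η D with
    | zero => exact fun p => by simpa [iterDifference, formEval_single] using h' [] p (by simp)
    | succ r ih =>
      refine ⟨fun p => by simpa [iterDifference, formEval_single] using h' [] p (by simp),
        fun u => ?_⟩
      refine ih (η := fun p => η (p + u) - η p) _ fun U p hU => ?_
      rw [← formEval_difference]
      refine (h' (u :: U) p (by simpa using hU)).trans (le_of_eq ?_)
      simp only [List.map_cons, List.prod_cons]
      ring
  · rintro h ⟨U, p, α⟩ hU
    replace h := h α
    simp only [DiffTerm.chain, DiffTerm.weight] at hU ⊢
    rw [mul_comm _ ‖α‖, ← mul_assoc]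
    generalize C * ‖α‖ = D at h
    induction U generalizing η r D with
    | nil => simpa [iterDifference, formEval_single] using h.norm_le p
    | cons u U ih =>
      obtain ⟨r, rfl⟩ : ∃ s, r = s + 1 := ⟨r - 1, by simp at hU; omega⟩
      have := ih (η := fun p => η (p + u) - η p) (r := r) (D := D * ‖u‖)
        (by simpa using hU) (h.2 u)
      rw [← formEval_difference] at this
      refine this.trans (le_of_eq ?_)
      simp only [List.map_cons, List.prod_cons]
      ring

theorem isBForm_iff {r : ℕ} {η : ℂ → V →ₗ[ℝ] F} :
    IsBForm r η ↔ ∃ C, ∀ α, DiffBound r (C * ‖α‖) fun p => η p α :=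
  exists_congr fun _ => norm_formEval_chain_le_iff

end Forms

theorem exists_smooth_cutoff {K U : Set ℂ} (hK : IsCompact K) (hU : IsOpen U) (hKU : K ⊆ U) :
    ∃ χ : ℂ → ℝ, ContDiff ℝ ∞ χ ∧ HasCompactSupport χ ∧ tsupport χ ⊆ U ∧
      ∀ᶠ w in 𝓝ˢ K, χ w = 1 := by
  obtain ⟨L, hL, hKL, hLU⟩ := exists_compact_between hK hU hKU
  obtain ⟨χ, h1, h0, -⟩ := exists_contMDiffMap_one_nhds_of_subset_interior
    (n := (⊤ : ℕ∞)) (modelWithCornersSelf ℝ ℂ) hK.isClosed hKL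
  have hs : tsupport (χ : ℂ → ℝ) ⊆ L :=
    closure_minimal (fun w hw => by_contra fun h => hw (h0 w h)) hL.isClosed
  exact ⟨χ, χ.contMDiff.contDiff, hL.of_isClosed_subset (isClosed_tsupport _) hs,
    hs.trans hLU, h1⟩

/-! ### Integrals depend only on the form near the support -/

section Integral

variable {V F : Type} [NormedAddCommGroup V] [NormedSpace ℝ V]
  [NormedAddCommGroup F] [NormedSpace ℝ F] {r : ℕ}

theorem exists_seq_pointed (J : Chain V r) :
    ∃ A : ℕ → (ℂ →₀ V), Tendsto (fun n => pointed r (A n)) atTop (𝓝 J) := by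
  obtain ⟨x, hx, hxJ⟩ := mem_closure_iff_seq_limit.1
    (UniformSpace.Completion.denseRange_coe (α := Pointed V r) J)
  choose A hA using hx
  obtain rfl : (fun n => (A n : Chain V r)) = x := funext hA
  exact ⟨fun n => ofPointed r (A n), hxJ⟩

theorem formEval_eq_zero {η : ℂ → V →ₗ[ℝ] F} {A : ℂ →₀ V} (h : ∀ p ∈ A.support, η p = 0) :
    formEval η A = 0 := by
  rw [formEval, Finsupp.lsum_apply]
  exact Finset.sum_eq_zero fun p hp => by simp [h p hp]

theorem formEval_sub (η ξ : ℂ → V →ₗ[ℝ] F) (A : ℂ →₀ V) :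
    formEval (fun w => η w - ξ w) A = formEval η A - formEval ξ A := by
  simp only [formEval, Finsupp.lsum_apply, Finsupp.sum, LinearMap.sub_apply,
    Finset.sum_sub_distrib]

theorem IsBForm.sub {η ξ : ℂ → V →ₗ[ℝ] F} (hη : IsBForm r η) (hξ : IsBForm r ξ) :
    IsBForm r (fun w => η w - ξ w) := by
  obtain ⟨a, ha⟩ := hη
  obtain ⟨b, hb⟩ := hξ
  refine ⟨a + b, fun x hx => ?_⟩
  rw [formEval_sub, add_mul]
  exact norm_sub_le_of_le (ha x hx) (hb x hx)

theorem IsBForm.smul {η : ℂ → V →ₗ[ℝ] F} (hη : IsBForm r η) {χ : ℂ → ℝ} {a : ℝ}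
    (hχ : DiffBound r a χ) : IsBForm r (fun w => χ w • η w) := by
  obtain ⟨b, hb⟩ := isBForm_iff.1 hη
  exact isBForm_iff.2 ⟨2 ^ r * (a * b), fun α =>
    (hχ.smul (hb α)).congr' (by ring) fun p => rfl⟩

variable [CompleteSpace F]

theorem IsBForm.tendsto_integral {η : ℂ → V →ₗ[ℝ] F} (hη : IsBForm r η) {J : Chain V r}
    {A : ℕ → (ℂ →₀ V)} (hA : Tendsto (fun n => pointed r (A n)) atTop (𝓝 J)) :
    Tendsto (fun n => formEval η (A n)) atTop (𝓝 (hη.integral J)) := by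
  refine ((hη.integral.continuous.tendsto J).comp hA).congr fun n => ?_
  exact extendChain_pointed _ hη (A n)

theorem IsBForm.norm_integral_le {η : ℂ → V →ₗ[ℝ] F} (hη : IsBForm r η) {C : ℝ} (hC : 0 ≤ C)
    (h : ∀ α, DiffBound r (C * ‖α‖) fun p => η p α) (J : Chain V r) :
    ‖hη.integral J‖ ≤ C * ‖J‖ := by
  obtain ⟨A, hA⟩ := exists_seq_pointed J
  refine le_of_tendsto_of_tendsto (hη.tendsto_integral hA).norm (hA.norm.const_mul C)
    (Eventually.of_forall fun n => ?_)
  refine (norm_le_of_terms (formEval η) hC (norm_formEval_chain_le_iff.2 h) (A n)).trans_eq ?_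
  rw [← norm_pointedL]
  rfl

theorem IsBForm.integral_sub {η ξ : ℂ → V →ₗ[ℝ] F} (hη : IsBForm r η) (hξ : IsBForm r ξ)
    (J : Chain V r) : (hη.sub hξ).integral J = hη.integral J - hξ.integral J := by
  obtain ⟨A, hA⟩ := exists_seq_pointed J
  refine tendsto_nhds_unique ((hη.sub hξ).tendsto_integral hA)
    (((hη.tendsto_integral hA).sub (hξ.tendsto_integral hA)).congr fun n => ?_)
  rw [formEval_sub]

/-- Forms in `B^r` with compact support disjoint from `X` have integral zero over `J`. -/
def Annihilates (F : Type) [NormedAddCommGroup F] [NormedSpace ℝ F] [CompleteSpace F]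
    (J : Chain V r) (X : Set ℂ) : Prop :=
  ∀ (η : ℂ → V →ₗ[ℝ] F) (hη : IsBForm r η) (C : Set ℂ), IsCompact C → Disjoint C X →
    (∀ w ∉ C, η w = 0) → hη.integral J = 0

/-- The complement of `C` is an open set containing `X`, non-empty because the plane is not compact,
so `J` is a limit of pointed chains on which `η` vanishes. -/
theorem annihilates_of_supportedBy {J : Chain V r} {X : Set ℂ} (h : SupportedBy J X) :
    Annihilates F J X := by
  intro η hη C hC hCX h0
  obtain ⟨A, hA, hAJ⟩ := h Cᶜ hC.isClosed.isOpen_compl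
    (Set.nonempty_compl.2 hC.ne_univ) hCX.symm.subset_compl_right
  refine tendsto_nhds_unique (hη.tendsto_integral hAJ) (tendsto_const_nhds.congr fun n => ?_)
  exact (formEval_eq_zero fun p hp => h0 p (hA n hp)).symm

theorem annihilates_univ (J : Chain V r) : Annihilates F J Set.univ := by
  intro η hη C hC hCX h0
  obtain ⟨A, hA⟩ := exists_seq_pointed J
  rw [Set.disjoint_univ] at hCX
  refine tendsto_nhds_unique (hη.tendsto_integral hA) (tendsto_const_nhds.congr fun n => ?_)
  exact (formEval_eq_zero fun p _ => h0 p (by simp [hCX])).symm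

/-- Split `η = χη + (1 - χ)η` with `χ = 1` near `C ∩ X` and `χ` supported off `Y`. The first form
has compact support off `Y`, the second vanishes outside a compact set off `X`. Unlike
`SupportedBy`, this dual notion passes easily to intersections. -/
theorem Annihilates.inter {J : Chain V r} {X Y : Set ℂ} (hX : Annihilates F J X)
    (hY : Annihilates F J Y) (hXc : IsClosed X) (hYc : IsClosed Y) : Annihilates F J (X ∩ Y) := by
  intro η hη C hC hCXY h0
  obtain ⟨χ, hχ, hχc, hχY, hχ1⟩ := exists_smooth_cutoff (hC.inter_right hXc) hYc.isOpen_compl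
    (fun w hw hwY => Set.disjoint_left.1 hCXY hw.1 ⟨hw.2, hwY⟩)
  obtain ⟨N, hN, hXN, hN1⟩ := mem_nhdsSet_iff_exists.1 hχ1
  obtain ⟨a, ha⟩ := exists_diffBound r hχ hχc
  have h1 := hY _ (hη.smul ha) (tsupport χ) hχc
    (Set.disjoint_left.2 fun w hw hwY => hχY hw hwY)
    (fun w hw => by simp [image_eq_zero_of_notMem_tsupport hw])
  have h2 := hX _ (hη.sub (hη.smul ha)) (C \ N) (hC.diff hN)
    (Set.disjoint_left.2 fun w hw hwX => hw.2 (hXN ⟨hw.1, hwX⟩))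
    (fun w hw => by
      by_cases hwC : w ∈ C
      · have hwN : w ∈ N := by_contra fun h => hw ⟨hwC, h⟩
        have : χ w = 1 := hN1 hwN
        simp [this]
      · simp [h0 w hwC])
  rw [hη.integral_sub (hη.smul ha), h1, sub_zero] at h2
  exact h2

/-- By compactness, `C` already misses the intersection of finitely many supporting sets. -/
theorem annihilates_chainSupport (J : Chain V r) : Annihilates F J (chainSupport J) := by
  intro η hη C hC hCJ h0
  let T : Set (Set ℂ) := {X | IsClosed X ∧ SupportedBy J X}
  obtain ⟨u, hu⟩ := hC.elim_finite_subfamily_closed (fun X : T => (X : Set ℂ)) (fun X => X.2.1) (by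
    rw [← Set.sInter_eq_iInter]
    exact hCJ.inter_eq)
  have key : ∀ u : Finset T, Annihilates F J (⋂ X ∈ u, (X : Set ℂ)) := by
    classical
    intro u
    induction u using Finset.induction_on with
    | empty => simpa using annihilates_univ J
    | insert X u _ ih =>
      rw [Finset.set_biInter_insert]
      exact (annihilates_of_supportedBy X.2.2).inter ih X.2.1
        (isClosed_biInter fun X _ => X.2.1)
  exact key u η hη C hC (Set.disjoint_iff_inter_eq_empty.2 hu) h0

/-- A form in `B^r` that vanishes near the support of `J` has integral zero over `J`. -/
theorem IsBForm.integral_eq_zero {η : ℂ → V →ₗ[ℝ] F} (hη : IsBForm r η) {J : Chain V r}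
    (h0 : ∀ᶠ w in 𝓝ˢ (chainSupport J), η w = 0) : hη.integral J = 0 := by
  obtain ⟨N, hN, hJN, hN0⟩ := mem_nhdsSet_iff_exists.1 h0
  obtain ⟨χ, hχ, hχc, hχs, hχ1⟩ := exists_smooth_cutoff (isCompact_closedBall (0 : ℂ) 1)
    (Metric.isOpen_ball (x := (0 : ℂ)) (ε := 2)) (Metric.closedBall_subset_ball (by norm_num))
  have hχ1' : ∀ w : ℂ, ‖w‖ ≤ 1 → χ w = 1 := fun w hw =>
    hχ1.self_of_nhdsSet w (by simpa using hw)
  obtain ⟨a, ha⟩ := exists_diffBound r hχ hχc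
  obtain ⟨b, hb⟩ := isBForm_iff.1 hη
  obtain ⟨b, hb0, hb⟩ : ∃ b, 0 ≤ b ∧ ∀ α, DiffBound r (b * ‖α‖) fun p => η p α :=
    ⟨max b 0, le_max_right _ _, fun α => (hb α).mono (by gcongr; exact le_max_left _ _)⟩
  have ha0 := ha.nonneg
  -- `η` need not have compact support, so it is cut off at scale `R`. If `χ_R = χ (w / R)` is one
  -- on the support of `A`, then `χ_R η` integrates to zero over `J` and `η - χ_R η` to zero over
  -- `A`; hence `∫_J η` is the integral of `η - χ_R η` over `J - A`. The bound on that form does not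
  -- depend on `R`, so `A` may tend to `J`.
  have bound : ∀ A : ℂ →₀ V, ‖hη.integral J‖ ≤ (b + 2 ^ r * (a * b)) * ‖J - pointed r A‖ := by
    intro A
    obtain ⟨R, hR1, hR⟩ : ∃ R : ℝ, 1 ≤ R ∧ ∀ p ∈ A.support, ‖p‖ ≤ R := by
      obtain ⟨R, hR⟩ := (A.support.finite_toSet.isCompact).isBounded.exists_norm_le
      exact ⟨max R 1, le_max_right _ _, fun p hp => (hR p hp).trans (le_max_left _ _)⟩
    have hR0 : 0 < R := one_pos.trans_le hR1
    have hRn : ‖((R⁻¹ : ℝ) : ℂ)‖ = R⁻¹ := by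
      rw [Complex.norm_real, Real.norm_of_nonneg (by positivity)]
    have haR := ha.comp_mul_left (c := ((R⁻¹ : ℝ) : ℂ)) (by rw [hRn]; exact inv_le_one_of_one_le₀ hR1)
    have h1 : (hη.smul haR).integral J = 0 := by
      refine annihilates_chainSupport J _ (hη.smul haR) (Metric.closedBall 0 (2 * R) \ N)
        ((isCompact_closedBall _ _).diff hN) (Set.disjoint_left.2 fun w hw hwJ => hw.2 (hJN hwJ))
        fun w hw => ?_
      by_cases hwN : w ∈ N
      · have : η w = 0 := hN0 hwN
        simp [this]
      · have hw' : 2 * R < ‖w‖ := by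
          by_contra h
          exact hw ⟨by simpa using h, hwN⟩
        suffices h : ((R⁻¹ : ℝ) : ℂ) * w ∉ tsupport χ by
          rw [image_eq_zero_of_notMem_tsupport h, zero_smul]
        intro h
        have := hχs h
        rw [Metric.mem_ball, dist_zero_right, norm_mul, hRn, inv_mul_lt_iff₀ hR0] at this
        linarith
    have hd := hη.sub (hη.smul haR)
    have h2 : hd.integral (pointed r A) = 0 := by
      refine (extendChain_pointed _ hd A).trans (formEval_eq_zero fun p hp => ?_)
      rw [hχ1' _ (by
        rw [norm_mul, hRn, inv_mul_le_iff₀ hR0, mul_one]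
        exact hR p hp), one_smul, sub_self]
    have h3 : hη.integral J = hd.integral (J - pointed r A) := by
      rw [map_sub, h2, hη.integral_sub (hη.smul haR), h1, sub_zero, sub_zero]
    rw [h3]
    refine hd.norm_integral_le (by positivity) (fun α => ?_) _
    refine ((hb α).add ((haR.smul (hb α)).clm_comp (-ContinuousLinearMap.id ℝ F))).mono
      ?_ |>.congr' rfl fun p => ?_
    · have : ‖-ContinuousLinearMap.id ℝ F‖ ≤ 1 := by
        rw [norm_neg]
        exact ContinuousLinearMap.norm_id_le
      have h4 := mul_le_mul_of_nonneg_right this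
        (by positivity : 0 ≤ 2 ^ r * (a * (b * ‖α‖)))
      linarith
    · simp [sub_eq_add_neg]
  obtain ⟨A, hA⟩ := exists_seq_pointed J
  have hlim : Tendsto (fun n => (b + 2 ^ r * (a * b)) * ‖J - pointed r (A n)‖) atTop (𝓝 0) := by
    simpa using (((tendsto_const_nhds (x := J)).sub hA).norm.const_mul (b + 2 ^ r * (a * b)))
  exact norm_le_zero_iff.1 (ge_of_tendsto' hlim fun n => bound (A n))

/-- Two extensions of `θ` in `B^r` differ by a form that vanishes near the support. -/
theorem IsBForm.hasHarrisonIntegral {η θ : ℂ → V →ₗ[ℝ] F} (hη : IsBForm r η) {J : Chain V r}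
    (h : ∀ᶠ w in 𝓝ˢ (chainSupport J), η w = θ w) : HasHarrisonIntegral J θ (hη.integral J) := by
  refine ⟨⟨η, hη, h⟩, fun ξ hξ hξθ => ?_⟩
  rw [← sub_eq_zero, ← hξ.integral_sub hη]
  refine (hξ.sub hη).integral_eq_zero ?_
  filter_upwards [h, hξθ] with w h1 h2
  rw [h1, h2, sub_self]

end Integral

/-! ### Forms `g dw` and rules for their integrals -/

theorem DiffBound.dwForm {r : ℕ} {C : ℝ} {g : ℂ → ℂ} (h : DiffBound r C g) (α : ℂ) :
    DiffBound r (C * ‖α‖) fun p => dwForm g p α := by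
  refine ((h.clm_comp ((ContinuousLinearMap.mul ℝ ℂ).flip α)).mono ?_).congr' rfl fun p => rfl
  rw [mul_comm]
  refine mul_le_mul_of_nonneg_left ?_ h.nonneg
  exact ContinuousLinearMap.opNorm_le_bound _ (norm_nonneg _) fun x => by simp

theorem DiffBound.isBForm_dwForm {r : ℕ} {C : ℝ} {g : ℂ → ℂ} (h : DiffBound r C g) :
    IsBForm r (DifferentialChains.dwForm g) :=
  isBForm_iff.2 ⟨C, h.dwForm⟩

theorem isBForm_dwForm (r : ℕ) {g : ℂ → ℂ} (hg : ContDiff ℝ ∞ g) (hc : HasCompactSupport g) :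
    IsBForm r (dwForm g) :=
  (exists_diffBound r hg hc).choose_spec.isBForm_dwForm

section Calculus

variable {V F F' : Type} [NormedAddCommGroup V] [NormedSpace ℝ V]
  [NormedAddCommGroup F] [NormedSpace ℝ F] [CompleteSpace F]
  [NormedAddCommGroup F'] [NormedSpace ℝ F'] [CompleteSpace F'] {r : ℕ} {J : Chain V r}

theorem HasHarrisonIntegral.sub {ξ θ : ℂ → V →ₗ[ℝ] F} {a b : F} (hξ : HasHarrisonIntegral J ξ a)
    (hθ : HasHarrisonIntegral J θ b) : HasHarrisonIntegral J (fun w => ξ w - θ w) (a - b) := by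
  obtain ⟨η, hη, hηξ⟩ := hξ.1
  obtain ⟨κ, hκ, hκθ⟩ := hθ.1
  rw [← hξ.2 η hη hηξ, ← hθ.2 κ hκ hκθ, ← hη.integral_sub hκ]
  refine (hη.sub hκ).hasHarrisonIntegral ?_
  filter_upwards [hηξ, hκθ] with w h1 h2
  rw [h1, h2]

theorem HasHarrisonIntegral.clm_comp (T : F →L[ℝ] F') {ξ : ℂ → V →ₗ[ℝ] F} {a : F}
    (hξ : HasHarrisonIntegral J ξ a) :
    HasHarrisonIntegral J (fun w => T.toLinearMap ∘ₗ ξ w) (T a) := by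
  obtain ⟨η, hη, hηξ⟩ := hξ.1
  have hT : IsBForm r fun w => T.toLinearMap ∘ₗ η w := by
    obtain ⟨C, hC⟩ := isBForm_iff.1 hη
    exact isBForm_iff.2 ⟨‖T‖ * C, fun α => ((hC α).clm_comp T).congr' (by ring) fun p => rfl⟩
  have he : hT.integral J = T a := by
    obtain ⟨A, hA⟩ := exists_seq_pointed J
    rw [← hξ.2 η hη hηξ]
    refine tendsto_nhds_unique (hT.tendsto_integral hA)
      (((T.continuous.tendsto _).comp (hη.tendsto_integral hA)).congr fun n => ?_)
    simp only [Function.comp_apply, formEval, Finsupp.lsum_apply, Finsupp.sum, map_sum]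
    rfl
  rw [← he]
  exact hT.hasHarrisonIntegral (hηξ.mono fun w h => by rw [h])

theorem contDiff_of_contDiffAt_tsupport {g : ℂ → ℂ} (h : ∀ w ∈ tsupport g, ContDiffAt ℝ ∞ g w) :
    ContDiff ℝ ∞ g := by
  refine contDiff_iff_contDiffAt.2 fun w => ?_
  by_cases hw : w ∈ tsupport g
  · exact h w hw
  · exact contDiffAt_const.congr_of_eventuallyEq (notMem_tsupport_iff_eventuallyEq.1 hw)

theorem contDiff_smul_of_differentiableOn {χ : ℂ → ℝ} {h : ℂ → ℂ} {U : Set ℂ}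
    (hχ : ContDiff ℝ ∞ χ) (hU : IsOpen U) (hχU : tsupport χ ⊆ U) (hh : DifferentiableOn ℂ h U) :
    ContDiff ℝ ∞ fun w => χ w • h w := by
  refine contDiff_of_contDiffAt_tsupport fun w hw => ?_
  have hwU : w ∈ U := hχU (tsupport_smul_subset_left χ h hw)
  exact hχ.contDiffAt.smul
    (((hh.contDiffOn hU (n := ∞)).contDiffAt (hU.mem_nhds hwU)).restrict_scalars ℝ)

end Calculus

/-! ### Stokes' theorem, primitives and winding numbers -/

section Stokes

variable {r : ℕ}

theorem isBForm_toSpanSingleton (r : ℕ) {G : ℂ → ℂ} (hG : ContDiff ℝ ∞ G)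
    (hc : HasCompactSupport G) : IsBForm r fun w => LinearMap.toSpanSingleton ℝ ℂ (G w) := by
  obtain ⟨C, hC⟩ := exists_diffBound r hG hc
  refine isBForm_iff.2 ⟨C, fun t => ?_⟩
  refine ((hC.clm_comp (t • ContinuousLinearMap.id ℝ ℂ)).mono ?_).congr' rfl fun p => by simp
  rw [mul_comm]
  refine mul_le_mul_of_nonneg_left ?_ hC.nonneg
  rw [norm_smul]
  exact mul_le_of_le_one_right (norm_nonneg t) ContinuousLinearMap.norm_id_le

theorem isBForm_fderiv (r : ℕ) {G : ℂ → ℂ} (hG : ContDiff ℝ ∞ G)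
    (hc : HasCompactSupport G) : IsBForm r fun w => (fderiv ℝ G w).toLinearMap := by
  obtain ⟨C, hC⟩ := exists_diffBound r (hG.fderiv_right (m := ∞) (by simp)) (hc.fderiv (𝕜 := ℝ))
  refine isBForm_iff.2 ⟨C, fun α => ?_⟩
  refine ((hC.clm_comp (ContinuousLinearMap.apply ℝ ℂ α)).mono ?_).congr' rfl fun p => by simp
  rw [mul_comm]
  refine mul_le_mul_of_nonneg_left ?_ hC.nonneg
  exact ContinuousLinearMap.opNorm_le_bound _ (norm_nonneg _) fun T => by
    simpa [mul_comm] using T.le_opNorm α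

/-- Pairing with `G` is continuous on chains of order `r + 2`, so it passes to the limit defining
the prederivative and yields the limit of the difference quotients of `G`. -/
theorem integral_prederivL {G : ℂ → ℂ} (hG : ContDiff ℝ ∞ G) (hc : HasCompactSupport G)
    (v : ℂ) (A : ℂ →₀ ℝ) :
    (isBForm_toSpanSingleton (r + 2) hG hc).integral (prederivL r v A) =
      formEval (fun p => LinearMap.toSpanSingleton ℝ ℂ (fderiv ℝ G p v)) A := by
  induction A using Finsupp.induction_linear with
  | zero => simp
  | add f g hf hg => simp only [map_add, hf, hg]
  | single p α =>
    set h := isBForm_toSpanSingleton (r + 2) hG hc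
    refine tendsto_nhds_unique ((h.integral.continuous.tendsto _).comp
      (tendsto_prederivPointed r v (single p α))) ?_
    have hd : HasDerivAt (fun t : ℝ => G (p + (t : ℂ) * v)) (fderiv ℝ G p v) 0 := by
      have h1 : HasDerivAt (fun t : ℝ => p + (t : ℂ) * v) v 0 := by
        simpa using (((Complex.ofRealCLM.hasDerivAt (x := (0 : ℝ))).mul_const v).const_add p)
      have h2 : HasFDerivAt G (fderiv ℝ G p) (p + ((0 : ℝ) : ℂ) * v) := by
        simpa using (hG.differentiable (by simp) p).hasFDerivAt
      exact h2.comp_hasDerivAt 0 h1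
    rw [formEval_single, LinearMap.toSpanSingleton_apply]
    refine ((hasDerivAt_iff_tendsto_slope_zero.1 hd).const_smul α).congr fun t => ?_
    have e : h.integral (pointed (r + 2) (difference ((t : ℂ) * v) (single p α))) =
        α • (G (p + (t : ℂ) * v) - G p) :=
      (extendChain_pointed _ h _).trans (by
        rw [difference_single, map_sub, formEval_single, formEval_single]
        simp [mul_sub])
    simp only [Function.comp_apply, map_smul, e, zero_add, Complex.ofReal_zero, zero_mul, add_zero]
    rw [smul_comm]

/-- This is `dG = ∂₁G dx + ∂₂G dy`: the two retractions read off the real and imaginary parts of a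
vector. -/
theorem formEval_fderiv {G : ℂ → ℂ} (B : ℂ →₀ ℂ) :
    formEval (fun p => LinearMap.toSpanSingleton ℝ ℂ (fderiv ℝ G p 1)) (mapCoeff (retract₁ 1) B) +
      formEval (fun p => LinearMap.toSpanSingleton ℝ ℂ (fderiv ℝ G p Complex.I))
        (mapCoeff (retract₁ Complex.I) B) =
      formEval (fun p => (fderiv ℝ G p).toLinearMap) B := by
  induction B using Finsupp.induction_linear with
  | zero => simp
  | add f g hf hg =>
    simp only [map_add, ← hf, ← hg]
    abel
  | single p α =>
    simp only [mapCoeff_single, formEval_single, LinearMap.toSpanSingleton_apply]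
    have e : α = α.re • (1 : ℂ) + α.im • Complex.I := by simp
    have h1 : retract₁ 1 α = α.re := by simp [retract₁, Complex.inner]
    have h2 : retract₁ Complex.I α = α.im := by simp [retract₁, Complex.inner]
    rw [h1, h2]
    conv_rhs => rw [e]
    simp only [ContinuousLinearMap.coe_coe, map_add, map_smul]

/-- Stokes' theorem for the exterior derivative of a smooth function with compact support. -/
theorem integral_boundary₁ {G : ℂ → ℂ} (hG : ContDiff ℝ ∞ G) (hc : HasCompactSupport G)
    (J : Chain ℂ (r + 1)) :
    (isBForm_toSpanSingleton (r + 2) hG hc).integral (boundary₁ r J) =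
      (isBForm_fderiv (r + 1) hG hc).integral J := by
  obtain ⟨A, hA⟩ := exists_seq_pointed J
  refine tendsto_nhds_unique
    ((((isBForm_toSpanSingleton (r + 2) hG hc).integral ∘L boundary₁ r).continuous.tendsto J).comp
      hA) (((isBForm_fderiv (r + 1) hG hc).tendsto_integral hA).congr fun n => ?_)
  have hb : ∀ v, prederivative r v (mapChain (r + 1) (retract₁ v) (pointed (r + 1) (A n))) =
      prederivL r v (mapCoeff (retract₁ v) (A n)) := fun v => by
    rw [mapChain, extendChain_pointed]
    exact extendChain_pointed _ _ _
  rw [Function.comp_apply, ContinuousLinearMap.comp_apply, boundary₁, _root_.add_apply,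
    ContinuousLinearMap.comp_apply, ContinuousLinearMap.comp_apply, hb, hb, map_add,
    integral_prederivL hG hc, integral_prederivL hG hc, formEval_fderiv]

variable {J : Chain ℂ (r + 1)}

theorem exists_bForm_dwForm {g : ℂ → ℂ} {N S : Set ℂ} (hS : IsCompact S) (hN : IsOpen N)
    (hSN : S ⊆ N) (hg : DifferentiableOn ℂ g N) (r : ℕ) :
    ∃ η, IsBForm r η ∧ ∀ᶠ w in 𝓝ˢ S, η w = dwForm g w := by
  obtain ⟨χ, hχ, hχc, hχN, hχ1⟩ := exists_smooth_cutoff hS hN hSN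
  refine ⟨_, isBForm_dwForm r (contDiff_smul_of_differentiableOn hχ hN hχN hg) hχc.smul_right, ?_⟩
  filter_upwards [hχ1] with w hw
  simp [dwForm, hw]

theorem harrisonIntegrable_dwForm {g : ℂ → ℂ} {N : Set ℂ} (hS : IsCompact (chainSupport J))
    (hN : IsOpen N) (hSN : chainSupport J ⊆ N) (hg : DifferentiableOn ℂ g N) :
    HarrisonIntegrable J (dwForm g) := by
  obtain ⟨η, hη, h⟩ := exists_bForm_dwForm hS hN hSN hg (r + 1)
  exact ⟨_, hη.hasHarrisonIntegral h⟩

/-- Near `supp J` the form is `d(χh)` with `χ` a cutoff, and by Stokes its integral is that of `χh`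
over `∂J = 0`. -/
theorem hasHarrisonIntegral_deriv {g h : ℂ → ℂ} {N : Set ℂ} (hJ : boundary₁ r J = 0)
    (hS : IsCompact (chainSupport J)) (hN : IsOpen N) (hSN : chainSupport J ⊆ N)
    (hh : ∀ w ∈ N, HasDerivAt h (g w) w) : HasHarrisonIntegral J (dwForm g) 0 := by
  obtain ⟨χ, hχ, hχc, hχN, hχ1⟩ := exists_smooth_cutoff hS hN hSN
  have hG := contDiff_smul_of_differentiableOn hχ hN hχN
    fun w hw => (hh w hw).differentiableAt.differentiableWithinAt
  have hGc : HasCompactSupport fun w => χ w • h w := hχc.smul_right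
  have h0 := integral_boundary₁ hG hGc J
  rw [hJ, map_zero] at h0
  rw [h0]
  refine (isBForm_fderiv (r + 1) hG hGc).hasHarrisonIntegral ?_
  obtain ⟨M, hM, hSM, hM1⟩ := mem_nhdsSet_iff_exists.1 hχ1
  filter_upwards [(hM.inter hN).mem_nhdsSet.2 (Set.subset_inter hSM hSN)] with w hw
  have he : (fun w => χ w • h w) =ᶠ[𝓝 w] h := by
    filter_upwards [hM.mem_nhds hw.1] with x hx
    have : χ x = 1 := hM1 hx
    rw [this, one_smul]
  have hd : HasFDerivAt h _ w := (hh w hw.2).hasFDerivAt.restrictScalars ℝ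
  rw [he.fderiv_eq, hd.fderiv]
  ext x
  simp [dwForm, mul_comm]

/-- The quotient `(w - ζ)/(w - ζ') = 1 + (ζ' - ζ)/(w - ζ')` stays in the unit disc about `1`, where
the principal logarithm is holomorphic; its logarithm is a primitive of `1/(w - ζ) - 1/(w - ζ')`. -/
theorem hasHarrisonIntegral_inv_sub_of_norm_lt {ζ ζ' c : ℂ} (hJ : boundary₁ r J = 0)
    (hS : IsCompact (chainSupport J)) (hζ : ∀ w ∈ chainSupport J, ‖ζ' - ζ‖ < ‖w - ζ'‖)
    (h : HasHarrisonIntegral J (dwForm fun w => 1 / (w - ζ)) c) :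
    HasHarrisonIntegral J (dwForm fun w => 1 / (w - ζ')) c := by
  have hN : IsOpen {w : ℂ | ‖ζ' - ζ‖ < ‖w - ζ'‖} :=
    isOpen_lt continuous_const (by fun_prop)
  have h0 : HasHarrisonIntegral J (dwForm fun w => 1 / (w - ζ) - 1 / (w - ζ')) 0 := by
    refine hasHarrisonIntegral_deriv (h := fun w => Complex.log ((w - ζ) / (w - ζ'))) hJ hS hN hζ
      fun w hw => ?_
    have hw : ‖ζ' - ζ‖ < ‖w - ζ'‖ := hw
    have h1 : w - ζ' ≠ 0 := norm_pos_iff.1 ((norm_nonneg _).trans_lt hw)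
    have e : (w - ζ) / (w - ζ') = 1 + (ζ' - ζ) / (w - ζ') := by
      field_simp
      ring
    have hs : (w - ζ) / (w - ζ') ∈ Complex.slitPlane := by
      rw [e]
      refine Complex.mem_slitPlane_of_norm_lt_one ?_
      rwa [norm_div, div_lt_one (norm_pos_iff.2 h1)]
    have h2 : w - ζ ≠ 0 := fun h2 => by
      simp [h2] at hs
    have hd : HasDerivAt (fun w => Complex.log ((w - ζ) / (w - ζ')))
        ((1 * (w - ζ') - (w - ζ) * 1) / (w - ζ') ^ 2 / ((w - ζ) / (w - ζ'))) w :=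
      (((hasDerivAt_id w).sub_const ζ).div ((hasDerivAt_id w).sub_const ζ') h1).clog hs
    convert hd using 1
    field_simp
  have := h.sub h0
  rw [sub_zero] at this
  convert this using 2 with w
  ext x
  simp only [dwForm, LinearMap.mulLeft_apply, LinearMap.sub_apply]
  ring

theorem isOpen_windingNumber_eq_zero (hJ : boundary₁ r J = 0) (hS : IsCompact (chainSupport J)) :
    IsOpen {ζ | ζ ∉ chainSupport J ∧ HasHarrisonIntegral J (dwForm fun w => 1 / (w - ζ)) 0} := by
  refine Metric.isOpen_iff.2 fun ζ hζ => ?_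
  obtain ⟨ε, hε, hb⟩ := Metric.isOpen_iff.1 hS.isClosed.isOpen_compl ζ hζ.1
  -- For `w` in the support, `|w - ζ| ≥ ε` and `|ζ' - ζ| < ε/2` force `|w - ζ'| > ε/2 > |ζ' - ζ|`.
  refine ⟨ε / 2, half_pos hε, fun ζ' hζ' => ⟨?_, ?_⟩⟩
  · exact hb (Metric.ball_subset_ball (by linarith) hζ')
  · refine hasHarrisonIntegral_inv_sub_of_norm_lt hJ hS (fun w hw => ?_) hζ.2
    have h1 : ε ≤ dist w ζ := le_of_not_gt fun h => hb h hw
    have h2 : dist ζ' ζ < ε / 2 := hζ'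
    have h3 := dist_triangle w ζ' ζ
    rw [← dist_eq_norm, ← dist_eq_norm]
    linarith

end Stokes

/-! ### The Cauchy–Pompeiu formula -/

section Pompeiu

open MeasureTheory

/-- Twice the Wirtinger derivative `∂g/∂z̄`. -/
noncomputable def dbar (g : ℂ → ℂ) (ζ : ℂ) : ℂ :=
  fderiv ℝ g ζ 1 + Complex.I * fderiv ℝ g ζ Complex.I

theorem continuous_dbar {g : ℂ → ℂ} (hg : ContDiff ℝ ∞ g) : Continuous (dbar g) := by
  have h := hg.continuous_fderiv (by simp)
  unfold dbar
  fun_prop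

theorem tsupport_dbar_subset (g : ℂ → ℂ) : tsupport (dbar g) ⊆ tsupport g := by
  refine closure_minimal (fun ζ hζ => ?_) (isClosed_tsupport g)
  by_contra h
  have h0 : fderiv ℝ g ζ = 0 :=
    image_eq_zero_of_notMem_tsupport fun h' => h (tsupport_fderiv_subset ℝ h')
  exact hζ (by simp [dbar, h0])

theorem hasCompactSupport_dbar {g : ℂ → ℂ} (hc : HasCompactSupport g) :
    HasCompactSupport (dbar g) :=
  hc.of_isClosed_subset (isClosed_tsupport _) (tsupport_dbar_subset g)

theorem dbar_congr {g h : ℂ → ℂ} {ζ : ℂ} (e : g =ᶠ[𝓝 ζ] h) : dbar g ζ = dbar h ζ := by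
  rw [dbar, dbar, e.fderiv_eq]

theorem dbar_eq_zero_of_differentiableAt {g : ℂ → ℂ} {ζ : ℂ} (h : DifferentiableAt ℂ g ζ) :
    dbar g ζ = 0 := by
  have hd : HasFDerivAt g _ ζ := h.hasDerivAt.hasFDerivAt.restrictScalars ℝ
  rw [dbar, hd.fderiv]
  simp [← mul_assoc]

theorem integral_dbar {g : ℂ → ℂ} (hg : ContDiff ℝ ∞ g) (hc : HasCompactSupport g) :
    ∫ ζ, dbar g ζ = 0 := by
  have hcont := hg.continuous_fderiv (by simp)
  have hi : ∀ v : ℂ, Integrable fun ζ => fderiv ℝ g ζ v := fun v =>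
    Continuous.integrable_of_hasCompactSupport (by fun_prop) (hc.fderiv_apply (𝕜 := ℝ) v)
  have h0 : ∀ v : ℂ, ∫ ζ, fderiv ℝ g ζ v = 0 := fun v => by
    -- Integration by parts against the constant `1`.
    have := integral_mul_fderiv_eq_neg_fderiv_mul_of_integrable (μ := volume) (𝕜 := ℂ)
      (f := fun _ : ℂ => (1 : ℂ)) (g := g) (v := v) (by simp) (by simpa using hi v)
      (by simpa using hg.continuous.integrable_of_hasCompactSupport hc)
      (fun x _ => differentiableAt_const _) (fun x _ => hg.differentiable (by simp) x)
    simpa using this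
  unfold dbar
  rw [integral_add (hi 1) ((hi Complex.I).const_mul _), integral_const_mul, h0, h0]
  simp

theorem integrable_div_sub {h : ℂ → ℂ} {w : ℂ} (hh : Continuous h) (hc : HasCompactSupport h)
    (h0 : h =ᶠ[𝓝 w] 0) : Integrable fun ζ => h ζ / (ζ - w) := by
  refine Continuous.integrable_of_hasCompactSupport (continuous_iff_continuousAt.2 fun ζ => ?_) ?_
  · by_cases hζ : ζ = w
    · subst hζ
      refine (continuousAt_const (y := (0 : ℂ))).congr ?_
      filter_upwards [h0] with x hx
      simp [hx]
    · exact hh.continuousAt.div (by fun_prop) (sub_ne_zero.2 hζ)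
  · exact hc.mono fun ζ hζ h' => hζ (by simp [h'])

/-- A radial bump function, equal to one near the origin. -/
noncomputable def radialBump (ζ : ℂ) : ℂ := (Real.smoothTransition (2 - ‖ζ‖ ^ 2) : ℝ)

theorem contDiff_radialBump : ContDiff ℝ ∞ radialBump :=
  Complex.ofRealCLM.contDiff.comp
    (Real.smoothTransition.contDiff.comp (contDiff_const.sub (contDiff_norm_sq ℝ)))

theorem radialBump_eq_one {ζ : ℂ} (h : ‖ζ‖ ≤ 1) : radialBump ζ = 1 := by
  rw [radialBump, Real.smoothTransition.one_of_one_le, Complex.ofReal_one]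
  nlinarith [norm_nonneg ζ]

theorem hasCompactSupport_radialBump : HasCompactSupport radialBump := by
  refine HasCompactSupport.intro (isCompact_closedBall 0 2) fun ζ hζ => ?_
  have : 2 < ‖ζ‖ := by simpa using hζ
  rw [radialBump, Real.smoothTransition.zero_of_nonpos, Complex.ofReal_zero]
  nlinarith

theorem dbar_radialBump (ζ : ℂ) :
    dbar radialBump ζ = ((-2 * deriv Real.smoothTransition (2 - ‖ζ‖ ^ 2) : ℝ) : ℂ) * ζ := by
  have hs : HasDerivAt Real.smoothTransition (deriv Real.smoothTransition (2 - ‖ζ‖ ^ 2))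
      (2 - ‖ζ‖ ^ 2) :=
    ((Real.smoothTransition.contDiff (n := ⊤)).differentiable (by simp) _).hasDerivAt
  have hn : HasFDerivAt (fun ζ : ℂ => 2 - ‖ζ‖ ^ 2) (-(2 • innerSL ℝ ζ)) ζ :=
    (hasStrictFDerivAt_norm_sq ζ).hasFDerivAt.const_sub 2
  have h0 := hs.comp_hasFDerivAt ζ hn
  have h : HasFDerivAt radialBump _ ζ :=
    Complex.ofRealCLM.hasFDerivAt.comp ζ h0
  rw [dbar, h.fderiv]
  apply Complex.ext <;> simp [Complex.inner] <;> ring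

/-- Division by `ζ` leaves a real radial function of constant sign. The value is `-2π`, but only its
being nonzero matters. -/
theorem integral_dbar_radialBump_ne_zero : ∫ ζ, dbar radialBump ζ / ζ ≠ 0 := by
  set s := fun ζ : ℂ => deriv Real.smoothTransition (2 - ‖ζ‖ ^ 2) with hs
  have e : (fun ζ => dbar radialBump ζ / ζ) =ᵐ[volume] fun ζ => ((-2 * s ζ : ℝ) : ℂ) := by
    filter_upwards [compl_mem_ae_iff.2 (measure_singleton (0 : ℂ))] with ζ hζ
    rw [dbar_radialBump, mul_div_cancel_right₀ _ (by simpa using hζ)]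
  rw [integral_congr_ae e, integral_complex_ofReal, integral_const_mul, Complex.ofReal_ne_zero]
  have hd : Continuous (deriv Real.smoothTransition) :=
    (Real.smoothTransition.contDiff (n := ⊤)).continuous_deriv (by simp)
  have hcont : Continuous s := by fun_prop
  -- The mean value theorem gives `c` in `(0, 1)` where the derivative is `1`; the point `√(2 - c)`
  -- is where `2 - ‖ζ‖ ^ 2` equals `c`.
  obtain ⟨c, hc, hc1⟩ := exists_deriv_eq_slope Real.smoothTransition one_pos
    Real.smoothTransition.continuous.continuousOn
    ((Real.smoothTransition.contDiff (n := ⊤)).differentiable (by simp)).differentiableOn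
  have hpos : 0 < ∫ ζ, s ζ := by
    refine hcont.integral_pos_of_hasCompactSupport_nonneg_nonzero (x := (√(2 - c) : ℂ)) ?_ ?_ ?_
    · refine HasCompactSupport.intro (isCompact_closedBall 0 2) fun ζ hζ => ?_
      have h2 : 2 < ‖ζ‖ := by simpa using hζ
      have : Real.smoothTransition =ᶠ[𝓝 (2 - ‖ζ‖ ^ 2)] fun _ => 0 := by
        filter_upwards [gt_mem_nhds (show 2 - ‖ζ‖ ^ 2 < 0 by nlinarith)] with x hx
        exact Real.smoothTransition.zero_of_nonpos hx.le
      rw [hs]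
      simp only [this.deriv_eq, deriv_const]
    · exact fun ζ => Real.smoothTransition.monotone.deriv_nonneg
    · have : (2 : ℝ) - ‖((√(2 - c) : ℝ) : ℂ)‖ ^ 2 = c := by
        rw [Complex.norm_real, Real.norm_of_nonneg (Real.sqrt_nonneg _),
          Real.sq_sqrt (by linarith [hc.2])]
        ring
      simp only [hs, this, hc1]
      simp
  linarith [hpos]

/-- The Cauchy–Pompeiu formula at a point near which the function is holomorphic. -/
theorem integral_dbar_div_sub {g : ℂ → ℂ} (hg : ContDiff ℝ ∞ g) (hc : HasCompactSupport g)
    {w : ℂ} {N : Set ℂ} (hN : IsOpen N) (hw : w ∈ N) (hgN : DifferentiableOn ℂ g N) :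
    ∫ ζ, dbar g ζ / (ζ - w) = g w * ∫ ζ, dbar radialBump ζ / ζ := by
  set b : ℂ → ℂ := fun ζ => radialBump (ζ - w)
  have hb : ContDiff ℝ ∞ b := contDiff_radialBump.comp (contDiff_id.sub contDiff_const)
  have hbc : HasCompactSupport b := hasCompactSupport_radialBump.comp_homeomorph
    (Homeomorph.subRight w)
  have hb1 : ∀ ζ ∈ Metric.ball w 1, b ζ = 1 := fun ζ hζ =>
    radialBump_eq_one (by rw [← dist_eq_norm]; exact (Metric.mem_ball.1 hζ).le)
  -- Subtracting a multiple of the bump makes `p` vanish at `w` and stay holomorphic nearby, so `p =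
  -- (ζ - w) q` with `q` smooth of compact support. Then `dbar p / (ζ - w) = dbar q` off `w`, which
  -- integrates to zero.
  set p : ℂ → ℂ := fun ζ => g ζ - g w * b ζ
  have hp : ContDiff ℝ ∞ p := hg.sub (contDiff_const.mul hb)
  have hpw : p w = 0 := by simp [p, hb1 w (Metric.mem_ball_self one_pos)]
  have hpc : HasCompactSupport p := hc.sub hbc.mul_left
  have hMo : IsOpen (N ∩ Metric.ball w 1) := hN.inter Metric.isOpen_ball
  have hM : N ∩ Metric.ball w 1 ∈ 𝓝 w := hMo.mem_nhds ⟨hw, Metric.mem_ball_self one_pos⟩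
  have hpM : DifferentiableOn ℂ p (N ∩ Metric.ball w 1) :=
    ((hgN.mono Set.inter_subset_left).sub_const (g w)).congr fun ζ hζ => by
      simp [p, hb1 ζ hζ.2]
  set q := dslope p w
  have hpq : ∀ ζ, (ζ - w) * q ζ = p ζ := fun ζ => by
    simpa [hpw] using sub_smul_dslope p w ζ
  have hq : ContDiff ℝ ∞ q := by
    refine contDiff_iff_contDiffAt.2 fun ζ => ?_
    by_cases hζ : ζ = w
    · subst hζ
      exact ((((Complex.differentiableOn_dslope hM).2 hpM).contDiffOn hMo).contDiffAt
        hM).restrict_scalars ℝ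
    · have h1 : ContDiffAt ℝ ∞ (fun x => (x - w)⁻¹ * p x) ζ :=
        ((contDiffAt_id.sub contDiffAt_const).inv (sub_ne_zero.2 hζ)).mul hp.contDiffAt
      refine h1.congr_of_eventuallyEq ?_
      filter_upwards [isOpen_ne.mem_nhds hζ] with x hx
      rw [← hpq x, inv_mul_cancel_left₀ (sub_ne_zero.2 hx)]
  have hqc : HasCompactSupport q := by
    refine HasCompactSupport.intro (hpc.isCompact.union (isCompact_singleton (x := w)))
      fun ζ hζ => ?_
    simp only [Set.mem_union, Set.mem_singleton_iff, not_or] at hζ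
    have := hpq ζ
    rw [image_eq_zero_of_notMem_tsupport hζ.1] at this
    exact (mul_eq_zero.1 this).resolve_left (sub_ne_zero.2 hζ.2)
  have hdp : ∀ ζ, dbar p ζ = dbar g ζ - g w * dbar radialBump (ζ - w) := fun ζ => by
    have h1 := (hg.differentiable (by simp) ζ).hasFDerivAt
    have h2 := (hb.differentiable (by simp) ζ).hasFDerivAt
    have h3 : HasFDerivAt p _ ζ := h1.sub (h2.const_mul (g w))
    have h4 : fderiv ℝ b ζ = fderiv ℝ radialBump (ζ - w) := fderiv_comp_sub w
    rw [dbar, dbar, dbar, h3.fderiv, h4]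
    simp only [FunLike.coe_sub, Pi.sub_apply, FunLike.coe_smul,
      Pi.smul_apply, smul_eq_mul]
    ring
  -- Leibniz rule; the factor `ζ - w` is holomorphic and its own `dbar` is `1 + I * I = 0`.
  have hdq : ∀ ζ, dbar p ζ = (ζ - w) * dbar q ζ := fun ζ => by
    have h1 := (hq.differentiable (by simp) ζ).hasFDerivAt
    have h2 : HasFDerivAt (fun ζ : ℂ => ζ - w) (ContinuousLinearMap.id ℝ ℂ) ζ :=
      (hasFDerivAt_id ζ).sub_const w
    have h3 := h2.mul h1
    have h4 : HasFDerivAt p _ ζ := h3.congr_of_eventuallyEq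
      (Eventually.of_forall fun x => (hpq x).symm)
    rw [dbar, dbar, h4.fderiv]
    simp only [_root_.add_apply, _root_.smul_apply, smul_eq_mul,
      ContinuousLinearMap.id_apply]
    linear_combination q ζ * Complex.I_mul_I
  have hig : Integrable fun ζ => dbar g ζ / (ζ - w) := by
    refine integrable_div_sub (continuous_dbar hg) (hasCompactSupport_dbar hc) ?_
    filter_upwards [hN.mem_nhds hw] with ζ hζ
    exact dbar_eq_zero_of_differentiableAt (hgN.differentiableAt (hN.mem_nhds hζ))
  have hir : Integrable fun ζ => dbar radialBump ζ / (ζ - 0) := by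
    refine integrable_div_sub (continuous_dbar contDiff_radialBump)
      (hasCompactSupport_dbar hasCompactSupport_radialBump) ?_
    filter_upwards [Metric.ball_mem_nhds (0 : ℂ) one_pos] with ζ hζ
    refine (dbar_congr (h := fun _ => 1) ?_).trans
      (dbar_eq_zero_of_differentiableAt (differentiableAt_const _))
    filter_upwards [Metric.isOpen_ball.mem_nhds hζ] with x hx
    exact radialBump_eq_one (by simpa using (Metric.mem_ball.1 hx).le)
  simp only [sub_zero] at hir
  have hib := (hir.comp_sub_right w).const_mul (g w)
  have h0 : ∫ ζ, (dbar g ζ / (ζ - w) - g w * (dbar radialBump (ζ - w) / (ζ - w))) = 0 := by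
    rw [← integral_dbar hq hqc]
    refine integral_congr_ae ?_
    filter_upwards [compl_mem_ae_iff.2 (measure_singleton w)] with ζ hζ
    have hζ : ζ - w ≠ 0 := sub_ne_zero.2 (by simpa using hζ)
    have h := hdq ζ
    rw [hdp] at h
    field_simp
    exact h
  rw [integral_sub hig hib, integral_const_mul, sub_eq_zero] at h0
  rw [h0, integral_sub_right_eq_self (fun ζ => dbar radialBump ζ / ζ) w]

end Pompeiu

/-! ### Cauchy's theorem for closed chains -/

section Cauchy

open MeasureTheory

theorem HasHarrisonIntegral.congr {V F : Type} [NormedAddCommGroup V] [NormedSpace ℝ V]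
    [NormedAddCommGroup F] [NormedSpace ℝ F] [CompleteSpace F] {r : ℕ} {J : Chain V r}
    {ξ θ : ℂ → V →ₗ[ℝ] F} {c : F} (h : HasHarrisonIntegral J ξ c)
    (e : ∀ᶠ w in 𝓝ˢ (chainSupport J), ξ w = θ w) : HasHarrisonIntegral J θ c := by
  obtain ⟨η, hη, hηξ⟩ := h.1
  rw [← h.2 η hη hηξ]
  refine hη.hasHarrisonIntegral ?_
  filter_upwards [e, hηξ] with w h1 h2
  rw [h2, h1]

theorem isClosed_chainSupport {V : Type} [NormedAddCommGroup V] [NormedSpace ℝ V] {r : ℕ}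
    (J : Chain V r) : IsClosed (chainSupport J) :=
  isClosed_sInter fun _ h => h.1

/-- The singular kernel `1 / w` gives no form in `B^r`; this substitute does, and agrees with it at
all the differences `w - ζ` that matter. -/
theorem exists_cauchyKernel {δ : ℝ} (hδ : 0 < δ) (R : ℝ) :
    ∃ k : ℂ → ℂ, ContDiff ℝ ∞ k ∧ HasCompactSupport k ∧ ∀ w, δ ≤ ‖w‖ → ‖w‖ ≤ R → k w = 1 / w := by
  obtain ⟨χ, hχ, hχc, hχU, hχ1⟩ := exists_smooth_cutoff
    ((isCompact_closedBall (0 : ℂ) R).diff (Metric.isOpen_ball (x := (0 : ℂ)) (ε := δ)))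
    (isOpen_compl_singleton (x := (0 : ℂ))) (fun w hw h => hw.2 (by
      rw [Set.mem_singleton_iff.1 h]
      exact Metric.mem_ball_self hδ))
  refine ⟨_, contDiff_smul_of_differentiableOn (h := fun w => 1 / w) hχ isOpen_compl_singleton hχU
    ((differentiableOn_const 1).div differentiableOn_id fun w hw => hw), hχc.smul_right,
    fun w h1 h2 => ?_⟩
  rw [hχ1.self_of_nhdsSet w ⟨by simpa using h2, by simpa using h1⟩, one_smul]

/-- The integral over `J` of a superposition of translates of `k` vanishes if those of the
translates do. -/
theorem integral_superposition_eq_zero {r : ℕ} {J : Chain ℂ r} {k a : ℂ → ℂ} {C : ℝ}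
    (hk : DiffBound r C k) (hkc : Continuous k) (ha : Continuous a) (hac : HasCompactSupport a)
    (hJ : ∀ ζ, a ζ ≠ 0 → ∀ h : IsBForm r (dwForm fun w => k (w - ζ)), h.integral J = 0) :
    ∃ h : IsBForm r (dwForm fun w => ∫ ζ, a ζ • k (w - ζ)), h.integral J = 0 := by
  have hai : Integrable a := ha.integrable_of_hasCompactSupport hac
  have hi : ∀ p, Integrable fun ζ => a ζ • k (p - ζ) := fun p =>
    Continuous.integrable_of_hasCompactSupport (by fun_prop) hac.smul_right
  have hkζ : ∀ ζ, DiffBound r C fun w => k (w - ζ) := fun ζ => by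
    simpa only [sub_eq_add_neg] using hk.comp_add_right (-ζ)
  have hB := (DiffBound.integral_smul hkζ hai hi).isBForm_dwForm
  refine ⟨hB, ?_⟩
  obtain ⟨A, hA⟩ := exists_seq_pointed J
  refine tendsto_nhds_unique (hB.tendsto_integral hA) ?_
  have hex : ∀ B : ℂ →₀ ℂ, formEval (dwForm fun w => ∫ ζ, a ζ • k (w - ζ)) B =
      ∫ ζ, a ζ * formEval (dwForm fun w => k (w - ζ)) B := fun B => by
    have hi' : ∀ p, Integrable fun ζ => a ζ * k (p - ζ) := hi
    simp only [formEval, Finsupp.lsum_apply, Finsupp.sum, Finset.mul_sum, dwForm, smul_eq_mul,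
      LinearMap.mulLeft_apply, ← mul_assoc]
    rw [integral_finsetSum _ fun p _ => (hi' p).mul_const _]
    exact Finset.sum_congr rfl fun p _ => (integral_mul_const _ _).symm
  -- Fubini is needed only for pointed chains, where it exchanges a finite sum and an integral. As
  -- each slice with `a ζ ≠ 0` integrates to zero over `J`, its value on `A n` is its integral over
  -- `A n - J`, small uniformly in `ζ`.
  have hbd : ∀ n, ‖formEval (dwForm fun w => ∫ ζ, a ζ • k (w - ζ)) (A n)‖ ≤
      (∫ ζ, ‖a ζ‖) * (C * ‖pointed r (A n) - J‖) := fun n => by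
    rw [hex, ← integral_mul_const]
    refine norm_integral_le_of_norm_le (hai.norm.mul_const _) (Eventually.of_forall fun ζ => ?_)
    by_cases hζ : a ζ = 0
    · simp [hζ]
    · rw [norm_mul]
      refine mul_le_mul_of_nonneg_left ?_ (norm_nonneg _)
      have hf := (hkζ ζ).isBForm_dwForm
      have h1 := hf.norm_integral_le hk.nonneg (hkζ ζ).dwForm (pointed r (A n) - J)
      rw [map_sub, hJ ζ hζ hf, sub_zero] at h1
      exact (congrArg norm (extendChain_pointed _ hf (A n))).symm.trans_le h1
  refine squeeze_zero_norm hbd ?_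
  simpa using ((hA.sub_const J).norm.const_mul C).const_mul (∫ ζ, ‖a ζ‖)

/-- Cauchy's theorem for closed chains: if `J` does not wind around the points outside `U`, then
holomorphic forms on `U` have integral zero over `J`. -/
theorem hasHarrisonIntegral_eq_zero {r : ℕ} {J : Chain ℂ (r + 1)} {U : Set ℂ} (hU : IsOpen U)
    (hUb : Bornology.IsBounded U) (hJ : boundary₁ r J = 0) (hJU : chainSupport J ⊆ U)
    (hInd : ∀ w ∉ U, windingNumber J w = 0) {F : ℂ → ℂ} (hF : DifferentiableOn ℂ F U) :
    HasHarrisonIntegral J (dwForm F) 0 := by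
  have hS : IsCompact (chainSupport J) :=
    Metric.isCompact_of_isClosed_isBounded (isClosed_chainSupport J) (hUb.subset hJU)
  set Z : Set ℂ :=
    {ζ | ζ ∉ chainSupport J ∧ HasHarrisonIntegral J (dwForm fun w => 1 / (w - ζ)) 0}
  have hZU : Zᶜ ⊆ U := by
    refine Set.compl_subset_comm.1 fun w hw => ⟨fun h => hw (hJU h), ?_⟩
    -- `harrisonIntegral` is zero by default, so well-definedness must be known before a vanishing
    -- winding number says anything.
    obtain ⟨c, hc⟩ : HarrisonIntegrable J (dwForm fun x => 1 / (x - w)) :=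
      harrisonIntegrable_dwForm hS hU hJU
        ((differentiableOn_const 1).div (differentiableOn_id.sub_const w) fun x hx =>
          sub_ne_zero.2 fun h => hw (h ▸ hx))
    have h0 := hInd w hw
    rw [windingNumber, hc.eq] at h0
    obtain rfl : c = 0 := by simpa [Real.pi_ne_zero] using h0
    exact hc
  have hZc : IsCompact Zᶜ := Metric.isCompact_of_isClosed_isBounded
    (isOpen_windingNumber_eq_zero hJ hS).isClosed_compl (hUb.subset hZU)
  obtain ⟨χ, hχ, hχc, hχU, hχ1⟩ := exists_smooth_cutoff hZc hU hZU
  obtain ⟨N, hN, hZN, hN1⟩ := mem_nhdsSet_iff_exists.1 hχ1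
  have hg := contDiff_smul_of_differentiableOn hχ hU hχU hF
  set g : ℂ → ℂ := fun w => χ w • F w
  have hgc : HasCompactSupport g := hχc.smul_right
  have hgF : ∀ w ∈ N ∩ U, g w = F w := fun w hw => by
    have : χ w = 1 := hN1 hw.1
    simp [g, this]
  have hNU := hN.inter hU
  have hgN : DifferentiableOn ℂ g (N ∩ U) := (hF.mono Set.inter_subset_right).congr hgF
  have hSN : chainSupport J ⊆ N ∩ U := fun w hw => ⟨hZN fun h => h.1 hw, hJU hw⟩
  -- `g` agrees with the holomorphic `F` on the open set `N ∩ U`, which contains `Zᶜ`.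
  have hTZ : tsupport (dbar g) ⊆ Z := by
    have h1 : tsupport (dbar g) ⊆ (N ∩ U)ᶜ := by
      refine closure_minimal (fun w hw hwN => hw ?_) hNU.isClosed_compl
      exact dbar_eq_zero_of_differentiableAt (hgN.differentiableAt (hNU.mem_nhds hwN))
    exact h1.trans (Set.compl_subset_comm.1 fun w hw => ⟨hZN hw, hZU hw⟩)
  have hTc : IsCompact (tsupport (dbar g)) := hasCompactSupport_dbar hgc
  have hdisj : Disjoint (chainSupport J) (tsupport (dbar g)) :=
    Set.disjoint_right.2 fun w hw => (hTZ hw).1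
  -- `δ` bounds `‖w - ζ‖` from below and `R` from above, for `w` near `supp J` and `ζ` in the
  -- support of `dbar g`; there `k (w - ζ)` is the true Cauchy kernel.
  obtain ⟨δ, hδ, hδd⟩ := hdisj.exists_thickenings hS hTc.isClosed
  obtain ⟨R, hR⟩ := Metric.isBounded_iff.1 (hUb.union hTc.isBounded)
  set M : Set ℂ := Metric.thickening δ (chainSupport J) ∩ (N ∩ U)
  have hM : IsOpen M := Metric.isOpen_thickening.inter hNU
  have hSM : ∀ᶠ w in 𝓝ˢ (chainSupport J), w ∈ M :=
    hM.mem_nhdsSet.2 (Set.subset_inter (Metric.self_subset_thickening hδ _) hSN)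
  obtain ⟨k, hk, hkc, hk1⟩ := exists_cauchyKernel hδ R
  have hkM : ∀ w ∈ M, ∀ ζ ∈ tsupport (dbar g), k (w - ζ) = 1 / (w - ζ) := fun w hw ζ hζ => by
    refine hk1 _ (le_of_not_gt fun h => ?_) ?_
    · exact Set.disjoint_left.1 hδd hw.1
        (Metric.mem_thickening_iff.2 ⟨ζ, hζ, by rwa [dist_eq_norm]⟩)
    · rw [← dist_eq_norm]
      exact hR (Or.inl hw.2.2) (Or.inr hζ)
  obtain ⟨C, hC⟩ := exists_diffBound (r + 1) hk hkc
  obtain ⟨hB, hB0⟩ := integral_superposition_eq_zero (J := J) hC hk.continuous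
    (continuous_dbar hg) (hasCompactSupport_dbar hgc) fun ζ hζ h => by
      have hζT := subset_tsupport _ hζ
      refine (hTZ hζT).2.2 _ h ?_
      filter_upwards [hSM] with w hw
      simp only [dwForm, hkM w hw ζ hζT]
  have hH := hB.hasHarrisonIntegral (J := J) (Eventually.of_forall fun _ => rfl)
  rw [hB0] at hH
  set c := ∫ ζ, dbar radialBump ζ / ζ with hc
  have hc0 : c ≠ 0 := integral_dbar_radialBump_ne_zero
  -- Pompeiu gives `g w * c` for the kernel `1/(ζ - w)`, while the superposition uses `1/(w - ζ)`:
  -- hence the sign in `-c⁻¹`.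
  have hH' := hH.clm_comp (ContinuousLinearMap.mul ℝ ℂ (-c⁻¹))
  rw [map_zero] at hH'
  refine hH'.congr ?_
  filter_upwards [hSM] with w hw
  have h1 : ∫ ζ, dbar g ζ • k (w - ζ) = -(F w * c) := by
    rw [← hgF w hw.2, hc, ← integral_dbar_div_sub hg hgc hNU hw.2 hgN, ← integral_neg]
    refine integral_congr_ae (Eventually.of_forall fun ζ => ?_)
    by_cases hζ : dbar g ζ = 0
    · simp [hζ]
    · simp only [hkM w hw ζ (subset_tsupport _ hζ), smul_eq_mul]
      rw [← neg_sub ζ w, div_neg, mul_neg, mul_one_div]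
  ext x
  simp only [dwForm, h1, LinearMap.comp_apply, ContinuousLinearMap.coe_coe,
    ContinuousLinearMap.mul_apply', LinearMap.mulLeft_apply]
  field_simp

end Cauchy

end DifferentialChains

/-! ### The integral formula -/

theorem mainTheorem8 (r : ℕ) (J : DifferentialChains.Chain ℂ (r + 1))
    (U : Set ℂ) (hUopen : IsOpen U) (hUbdd : Bornology.IsBounded U)
    (hclosed : DifferentialChains.boundary₁ r J = 0)
    (hsupp : DifferentialChains.chainSupport J ⊆ U)
    (hInd : ∀ w ∉ U, DifferentialChains.windingNumber J w = 0)
    (hK : ∃ K : DifferentialChains.Chain ℝ r,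
      DifferentialChains.mass K < ⊤ ∧ DifferentialChains.IsBoundaryOf J K)
    (f : ℂ → ℂ) (hf : DifferentiableOn ℂ f U)
    (z : ℂ) (hzU : z ∈ U) (hzJ : z ∉ DifferentialChains.chainSupport J) :
    DifferentialChains.HarrisonIntegrable J
        (DifferentialChains.dwForm fun w => 1 / (w - z)) ∧
      DifferentialChains.HarrisonIntegrable J
        (DifferentialChains.dwForm fun w => f w / (w - z)) ∧
      f z * DifferentialChains.windingNumber J z =
        1 / (2 * Real.pi * Complex.I) *
          DifferentialChains.harrisonIntegral J
            (DifferentialChains.dwForm fun w => f w / (w - z)) := by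
  open DifferentialChains in
  have hS : IsCompact (chainSupport J) :=
    Metric.isCompact_of_isClosed_isBounded (isClosed_chainSupport J) (hUbdd.subset hsupp)
  have hN : IsOpen (U ∩ {z}ᶜ) := hUopen.inter isOpen_compl_singleton
  have hSN : chainSupport J ⊆ U ∩ {z}ᶜ := fun w hw => ⟨hsupp hw, fun h => hzJ (h ▸ hw)⟩
  have hd : ∀ h : ℂ → ℂ, DifferentiableOn ℂ h U →
      DifferentiableOn ℂ (fun w => h w / (w - z)) (U ∩ {z}ᶜ) := fun h hh =>
    (hh.mono Set.inter_subset_left).div (differentiableOn_id.sub_const z)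
      fun w hw => sub_ne_zero.2 hw.2
  have h1 := harrisonIntegrable_dwForm hS hN hSN (hd _ (differentiableOn_const 1))
  have h2 := harrisonIntegrable_dwForm hS hN hSN (hd f hf)
  refine ⟨h1, h2, ?_⟩
  obtain ⟨c₁, hc₁⟩ := h1
  obtain ⟨c₂, hc₂⟩ := h2
  -- The singularity of the difference quotient at `z` is removable, so Cauchy's theorem applies to
  -- `dslope f z` on all of `U`; near `supp J`, which avoids `z`, it is `f w / (w - z) - f z / (w -
  -- z)`.
  have h3 := hasHarrisonIntegral_eq_zero hUopen hUbdd hclosed hsupp hInd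
    ((Complex.differentiableOn_dslope (hUopen.mem_nhds hzU)).2 hf)
  have h4 := (hc₂.sub (hc₁.clm_comp (ContinuousLinearMap.mul ℝ ℂ (f z)))).congr
    (θ := dwForm (dslope f z)) (by
      filter_upwards [hN.mem_nhdsSet.2 hSN] with w hw
      have hwz : w ≠ z := hw.2
      ext x
      simp only [dwForm, dslope_of_ne f hwz, slope_def_field, LinearMap.sub_apply,
        LinearMap.comp_apply, ContinuousLinearMap.coe_coe, ContinuousLinearMap.mul_apply',
        LinearMap.mulLeft_apply]
      ring)
  have h5 : c₂ - f z * c₁ = 0 := h4.eq.symm.trans h3.eq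
  rw [windingNumber, hc₁.eq, hc₂.eq, sub_eq_zero.1 h5]
  ring
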